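/- Let $\mathbb K$ be $\mathbb R$ or $\mathbb C$, let $n\in\mathbb N$ and $\lambda\in\mathbb K$, and write $\partial_i=\partial/\partial x^i$ and $\partial_{\xi_i}=\partial/\partial\xi_i$; repeated indices are summed. Let $\mathcal D_\lambda(\mathbb R^n)$ be the space of linear differential operators $A=\sum_\alpha a_\alpha\partial^\alpha$ (finite sum, $a_\alpha\in C^\infty(\mathbb R^n,\mathbb K)$) acting on $\lambda$-densities $\phi\,|dx^1\wedge\dots\wedge dx^n|^\lambda$. A real vector field $X=X^i\partial_i$ acts on densities by $L^\lambda_X\phi=X^i\partial_i\phi+\lambda(\partial_iX^i)\phi$ and on $\mathcal D_\lambda(\mathbb R^n)$ by $\mathcal L^\lambda_X(A)=L^\lambda_X\circ A-A\circ L^\lambda_X$. Let $\mathrm{Pol}(T^*\mathbb R^n)=\bigoplus_k\mathcal S^k$ be the space of polynomials in $\xi_1,\dots,\xi_n$ with coefficients in $C^\infty(\mathbb R^n,\mathbb K)$, where $\mathcal S^k$ is the part homogeneous of degree $k$ (symmetric contravariant $k$-tensor fields); $X$ acts on it by $L_X=X^i\partial_i-\xi_j(\partial_iX^j)\partial_{\xi_i}$.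 As vector spaces, $\mathcal D_\lambda(\mathbb R^n)$ and $\mathrm{Pol}(T^*\mathbb R^n)$ are identified by $\sum a_\alpha\partial^\alpha\leftrightarrow\sum a_\alpha\xi^\alpha$. Let $\mathrm{sl}(n+1,\mathbb R)$ be the Lie algebra of vector fields on $\mathbb R^n$ spanned over $\mathbb R$ by $\partial_j$, $x^i\partial_j$ and $x^i\mathcal E$, where $\mathcal E=x^j\partial_j$. A symbol map is a $\mathbb K$-linear bijection $\sigma:\mathcal D_\lambda(\mathbb R^n)\to\mathrm{Pol}(T^*\mathbb R^n)$ such that, for every $A=\sum a_\alpha\partial^\alpha$ of order $k$, the highest-degree homogeneous component of $\sigma(A)$ is the principal symbol $\sum_{|\alpha|=k}a_\alpha\xi^\alpha$. It is $\mathrm{sl}(n+1,\mathbb R)$-equivariant if $\sigma(\mathcal L^\lambda_X(A))=L_X(\sigma(A))$ for all $X\in\mathrm{sl}(n+1,\mathbb R)$ and all $A\in\mathcal D_\lambda(\mathbb R^n)$, and differential if, for every $k$, its restriction to $\mathcal S^k$ is a differential operator. Let $\mathrm{div}$ be the divergence of symmetric contravariant tensor fields, $(\mathrm{div}\,a)^{i_1\dots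 i_{k-1}}=\partial_j a^{i_1\dots i_{k-1}j}$ on $\mathcal S^k$ for $k\ge 1$; equivalently $\mathrm{div}=\frac1k\,\partial_i\partial_{\xi_i}$ on $\mathcal S^k$. **Theorem.** For every $\lambda$ there is exactly one $\mathrm{sl}(n+1,\mathbb R)$-equivariant symbol map $\sigma_\lambda:\mathcal D_\lambda(\mathbb R^n)\to\mathrm{Pol}(T^*\mathbb R^n)$. It is differential, and for every $k\ge 0$ $$\sigma_\lambda\big|_{\mathcal S^k}=\sum_{\ell=0}^{k}c^k_\ell\,\mathrm{div}^{\,k-\ell},\qquad c^k_\ell=(-1)^{k-\ell}\,\frac{\binom{k}{\ell}\binom{(n+1)\lambda+k-1}{k-\ell}}{\binom{k+\ell+n}{k-\ell}},$$ where $\binom{x}{m}=\frac{x(x-1)\cdots(x-m+1)}{m!}$ for $x\in\mathbb K$. -/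

import Mathlib

open scoped ContDiff

noncomputable section

namespace ProjectiveSymbol

/-- Smooth `𝕜`-valued functions on `ℝⁿ`, as a subalgebra of all functions, where `𝕜` is `ℝ` or `ℂ`.
(Smoothness does not depend on the norm chosen on `ℝⁿ`.) -/
def smoothSubalgebra (n : ℕ) (𝕜 : Type*) [RCLike 𝕜] : Subalgebra 𝕜 ((Fin n → ℝ) → 𝕜) where
  carrier := {f | ContDiff ℝ ∞ f}
  mul_mem' {f g} (hf : ContDiff ℝ ∞ f) (hg : ContDiff ℝ ∞ g) := (hf.mul hg : ContDiff ℝ ∞ (f * g))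
  add_mem' {f g} (hf : ContDiff ℝ ∞ f) (hg : ContDiff ℝ ∞ g) := (hf.add hg : ContDiff ℝ ∞ (f + g))
  algebraMap_mem' c := (contDiff_const : ContDiff ℝ ∞ fun _ : Fin n → ℝ => c)

/-- The algebra `C^∞(ℝⁿ)` of smooth `𝕜`-valued functions on `ℝⁿ`. -/
def Smooth (n : ℕ) (𝕜 : Type*) [RCLike 𝕜] : Type _ := ↥(smoothSubalgebra n 𝕜)

variable {n : ℕ} {𝕜 : Type*} [RCLike 𝕜]

instance : CommRing (Smooth n 𝕜) := inferInstanceAs (CommRing ↥(smoothSubalgebra n 𝕜))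

instance : Algebra 𝕜 (Smooth n 𝕜) := inferInstanceAs (Algebra 𝕜 ↥(smoothSubalgebra n 𝕜))

instance : FunLike (Smooth n 𝕜) (Fin n → ℝ) 𝕜 where
  coe f := f.1
  coe_injective := Subtype.coe_injective

/-- A smooth function as an element of `C^∞(ℝⁿ)`. -/
def Smooth.mk (f : (Fin n → ℝ) → 𝕜) (hf : ContDiff ℝ ∞ f) : Smooth n 𝕜 := ⟨f, hf⟩

@[simp] theorem Smooth.mk_apply (f : (Fin n → ℝ) → 𝕜) (hf : ContDiff ℝ ∞ f) (x : Fin n → ℝ) :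
    Smooth.mk f hf x = f x := rfl

@[simp] theorem Smooth.coe_mk (f : (Fin n → ℝ) → 𝕜) (hf : ContDiff ℝ ∞ f) :
    ⇑(Smooth.mk f hf) = f := rfl

@[simp] theorem Smooth.zero_apply (x : Fin n → ℝ) : (0 : Smooth n 𝕜) x = 0 := rfl

@[simp] theorem Smooth.add_apply (f g : Smooth n 𝕜) (x : Fin n → ℝ) : (f + g) x = f x + g x := rfl

@[simp] theorem Smooth.mul_apply (f g : Smooth n 𝕜) (x : Fin n → ℝ) : (f * g) x = f x * g x := rfl

@[simp] theorem Smooth.smul_apply (c : 𝕜) (f : Smooth n 𝕜) (x : Fin n → ℝ) :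
    (c • f) x = c * f x := rfl

/-- Evaluation at a point. -/
def Smooth.eval (x : Fin n → ℝ) : Smooth n 𝕜 →+* 𝕜 where
  toFun f := f x
  map_one' := rfl
  map_mul' _ _ := rfl
  map_zero' := rfl
  map_add' _ _ := rfl

@[simp] theorem Smooth.eval_apply (x : Fin n → ℝ) (f : Smooth n 𝕜) : Smooth.eval x f = f x := rfl

theorem Smooth.contDiff (f : Smooth n 𝕜) : ContDiff ℝ ∞ f := f.2

theorem Smooth.differentiableAt (f : Smooth n 𝕜) (x : Fin n → ℝ) : DifferentiableAt ℝ f x :=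
  f.contDiff.differentiable (by simp) x

theorem Smooth.contDiff_fderiv (f : Smooth n 𝕜) : ContDiff ℝ ∞ (fderiv ℝ f) :=
  f.contDiff.fderiv_right (by simp)

/-- The partial derivative `∂ᵢ = ∂/∂xⁱ` on `C^∞(ℝⁿ)`. -/
def pd (i : Fin n) : Module.End 𝕜 (Smooth n 𝕜) where
  toFun f := Smooth.mk (fun x => fderiv ℝ f x (Pi.single i 1))
    (f.contDiff_fderiv.clm_apply contDiff_const)
  map_add' f g := DFunLike.ext _ _ fun x =>
    congrArg (fun L => L (Pi.single i 1)) (fderiv_add (f.differentiableAt x) (g.differentiableAt x))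
  map_smul' c f := DFunLike.ext _ _ fun x =>
    congrArg (fun L => L (Pi.single i 1)) (fderiv_const_smul (f.differentiableAt x) c)

theorem pd_apply (i : Fin n) (f : Smooth n 𝕜) (x : Fin n → ℝ) :
    pd i f x = fderiv ℝ f x (Pi.single i 1) := rfl

theorem pd_mul (i : Fin n) (f g : Smooth n 𝕜) : pd i (f * g) = f * pd i g + pd i f * g := by
  refine DFunLike.ext _ _ fun x => ?_
  have h := fderiv_mul (f.differentiableAt x) (g.differentiableAt x)
  refine Eq.trans (congrArg (fun L => L (Pi.single i 1)) h) ?_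
  simp [pd_apply]
  ring

theorem pd_commute (i j : Fin n) : Commute (pd (𝕜 := 𝕜) i) (pd j) := by
  have key : ∀ (a b : Fin n) (f : Smooth n 𝕜) (x : Fin n → ℝ),
      pd a (pd b f) x = fderiv ℝ (fderiv ℝ f) x (Pi.single a 1) (Pi.single b 1) := by
    intro a b f x
    have h : DifferentiableAt ℝ (fderiv ℝ f) x := f.contDiff_fderiv.differentiable (by simp) x
    have h' := fderiv_clm_apply h (differentiableAt_const (Pi.single b (1 : ℝ) : Fin n → ℝ))
    refine Eq.trans (congrArg (fun L => L (Pi.single a 1)) h') ?_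
    simp
  refine LinearMap.ext fun f => DFunLike.ext _ _ fun x => ?_
  rw [Module.End.mul_apply, Module.End.mul_apply, key, key]
  have hf : ContDiffAt ℝ ∞ f x := f.contDiff.contDiffAt
  exact (hf.isSymmSndFDerivAt (by simpa using (ENat.LEInfty.out : (2 : WithTop ℕ∞) ≤ ∞))) _ _

theorem pd_pow_pairwise (α : Fin n →₀ ℕ) : Set.Pairwise (↑(Finset.univ : Finset (Fin n)))
    (Function.onFun Commute fun i => pd (𝕜 := 𝕜) i ^ α i) :=
  fun i _ j _ _ => (pd_commute i j).pow_pow (α i) (α j)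

/-- The iterated partial derivative `∂^α = ∂₁^{α₁} ⋯ ∂ₙ^{αₙ}` for a multi-index `α`. -/
def dpow (α : Fin n →₀ ℕ) : Module.End 𝕜 (Smooth n 𝕜) :=
  Finset.univ.noncommProd (fun i => pd i ^ α i) (pd_pow_pairwise α)

/-- Functions on `T*ℝⁿ` that are polynomial on the fibres: polynomials in `ξ₁, …, ξₙ` with
coefficients in `C^∞(ℝⁿ)`. -/
abbrev Pol (n : ℕ) (𝕜 : Type*) [RCLike 𝕜] : Type _ := MvPolynomial (Fin n) (Smooth n 𝕜)

/-- The `𝕜`-linear map on `Pol(T*ℝⁿ)` given on each term `a ξ^α` by `a ↦ g α a`. -/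
def termwise {M : Type*} [AddCommMonoid M] [Module 𝕜 M]
    (g : (Fin n →₀ ℕ) → Smooth n 𝕜 →ₗ[𝕜] M) : Pol n 𝕜 →ₗ[𝕜] M :=
  have key : ∀ (P : Pol n 𝕜) (s : Finset (Fin n →₀ ℕ)), P.support ⊆ s →
      ∑ α ∈ P.support, g α (P.coeff α) = ∑ α ∈ s, g α (P.coeff α) := by
    intro P s hs
    refine Finset.sum_subset hs fun α _ hα => ?_
    rw [MvPolynomial.notMem_support_iff.mp hα, map_zero]
  { toFun := fun P => ∑ α ∈ P.support, g α (P.coeff α)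
    map_add' := by
      classical
      intro P Q
      rw [key P (P.support ∪ Q.support) Finset.subset_union_left,
        key Q (P.support ∪ Q.support) Finset.subset_union_right,
        key (P + Q) (P.support ∪ Q.support) MvPolynomial.support_add, ← Finset.sum_add_distrib]
      exact Finset.sum_congr rfl fun α _ => by rw [MvPolynomial.coeff_add, map_add]
    map_smul' := by
      intro c P
      rw [key (c • P) P.support MvPolynomial.support_smul, RingHom.id_apply, Finset.smul_sum]
      exact Finset.sum_congr rfl fun α _ => by rw [MvPolynomial.coeff_smul, map_smul] }

theorem termwise_monomial {M : Type*} [AddCommMonoid M] [Module 𝕜 M]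
    (g : (Fin n →₀ ℕ) → Smooth n 𝕜 →ₗ[𝕜] M) (α : Fin n →₀ ℕ) (a : Smooth n 𝕜) :
    termwise g (MvPolynomial.monomial α a) = g α a := by
  classical
  have h : termwise g (MvPolynomial.monomial α a) =
      ∑ β ∈ (MvPolynomial.monomial α a).support, g β ((MvPolynomial.monomial α a).coeff β) := rfl
  rw [h, MvPolynomial.support_monomial]
  by_cases ha : a = 0
  · simp [ha]
  · simp [ha]

/-- Substituting `∂ᵢ` for `ξᵢ` with the coefficients on the left (normal ordering):
`∑ a_α ξ^α ↦ ∑ a_α ∂^α`, as an operator on `C^∞(ℝⁿ)`. -/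
def op : Pol n 𝕜 →ₗ[𝕜] Module.End 𝕜 (Smooth n 𝕜) :=
  termwise fun α => LinearMap.mulRight 𝕜 (dpow α) ∘ₗ (LinearMap.mul 𝕜 (Smooth n 𝕜))

/-- Linear differential operators on `ℝⁿ`: the operators `∑ a_α ∂^α` (finite sum) with smooth
coefficients. A `λ`-density `φ |dx¹ ∧ ⋯ ∧ dxⁿ|^λ` is represented by its coefficient `φ`, so that the
underlying space of `D_λ(ℝⁿ)` is this space for every `λ`. -/
def DiffOp (n : ℕ) (𝕜 : Type*) [RCLike 𝕜] : Submodule 𝕜 (Module.End 𝕜 (Smooth n 𝕜)) :=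
  LinearMap.range op

theorem op_monomial (α : Fin n →₀ ℕ) (a f : Smooth n 𝕜) :
    op (MvPolynomial.monomial α a) f = a * dpow α f := by
  rw [op, termwise_monomial]
  rfl

theorem dpow_add (α β : Fin n →₀ ℕ) : dpow (𝕜 := 𝕜) (α + β) = dpow α * dpow β := by
  unfold dpow
  refine Eq.trans (Finset.noncommProd_congr rfl (fun i _ => ?_) _)
    (Finset.noncommProd_mul_distrib (fun i => pd (𝕜 := 𝕜) i ^ α i) (fun i => pd i ^ β i)
      (pd_pow_pairwise α) (pd_pow_pairwise β)
      (fun i _ j _ _ => (pd_commute i j).pow_pow (β i) (α j)))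
  simp [pow_add]

theorem dpow_zero : dpow (n := n) (𝕜 := 𝕜) 0 = 1 := by
  refine Eq.trans (Finset.noncommProd_eq_pow_card _ _ _ 1 fun i _ => ?_) (one_pow _)
  simp

theorem dpow_single (i : Fin n) : dpow (𝕜 := 𝕜) (Finsupp.single i 1) = pd i := by
  refine Eq.trans (Finset.noncommProd_erase_mul Finset.univ (Finset.mem_univ i)
    (fun j => pd (𝕜 := 𝕜) j ^ (Finsupp.single i 1 : Fin n →₀ ℕ) j) (pd_pow_pairwise _)).symm ?_
  refine Eq.trans (congrArg₂ (· * ·) (Eq.trans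
    (Finset.noncommProd_eq_pow_card _ _ _ 1 fun j hj => ?_) (one_pow _)) rfl) ?_
  · simp [Finsupp.single_eq_of_ne (Finset.ne_of_mem_erase hj)]
  · simp

theorem mul_op_mem (a : Smooth n 𝕜) {B : Module.End 𝕜 (Smooth n 𝕜)} (hB : B ∈ DiffOp n 𝕜) :
    LinearMap.mulLeft 𝕜 a * B ∈ DiffOp n 𝕜 := by
  obtain ⟨P, rfl⟩ := hB
  induction P using MvPolynomial.induction_on' with
  | monomial α b =>
    refine ⟨MvPolynomial.monomial α (a * b), LinearMap.ext fun f => ?_⟩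
    simp [op_monomial, mul_assoc]
  | add P Q hP hQ =>
    rw [map_add, mul_add]
    exact Submodule.add_mem _ hP hQ

theorem pd_op_mem (i : Fin n) {B : Module.End 𝕜 (Smooth n 𝕜)} (hB : B ∈ DiffOp n 𝕜) :
    pd i * B ∈ DiffOp n 𝕜 := by
  obtain ⟨P, rfl⟩ := hB
  induction P using MvPolynomial.induction_on' with
  | monomial α b =>
    refine ⟨MvPolynomial.monomial (Finsupp.single i 1 + α) b + MvPolynomial.monomial α (pd i b),
      LinearMap.ext fun f => ?_⟩
    simp [op_monomial, dpow_add, dpow_single, pd_mul]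
  | add P Q hP hQ =>
    rw [map_add, mul_add]
    exact Submodule.add_mem _ hP hQ

/-- Compositions of differential operators are differential operators. -/
theorem comp_mem {A B : Module.End 𝕜 (Smooth n 𝕜)} (hA : A ∈ DiffOp n 𝕜) (hB : B ∈ DiffOp n 𝕜) :
    A * B ∈ DiffOp n 𝕜 := by
  have hpow : ∀ (i : Fin n) (m : ℕ) {B : Module.End 𝕜 (Smooth n 𝕜)}, B ∈ DiffOp n 𝕜 →
      pd i ^ m * B ∈ DiffOp n 𝕜 := by
    intro i m
    induction m with
    | zero => intro B hB; simpa using hB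
    | succ m ih => intro B hB; rw [pow_succ, mul_assoc]; exact ih (pd_op_mem i hB)
  have hd : ∀ α : Fin n →₀ ℕ, ∀ {B : Module.End 𝕜 (Smooth n 𝕜)}, B ∈ DiffOp n 𝕜 →
      dpow α * B ∈ DiffOp n 𝕜 := by
    intro α
    refine Finset.noncommProd_induction _ _ _
      (fun T => ∀ {B : Module.End 𝕜 (Smooth n 𝕜)}, B ∈ DiffOp n 𝕜 → T * B ∈ DiffOp n 𝕜) ?_ ?_ ?_
    · intro S T hS hT B hB
      rw [mul_assoc]
      exact hS (hT hB)
    · intro B hB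
      simpa using hB
    · intro i _ B hB
      exact hpow i (α i) hB
  obtain ⟨P, rfl⟩ := hA
  induction P using MvPolynomial.induction_on' with
  | monomial α b =>
    have h : op (MvPolynomial.monomial α b) * B = LinearMap.mulLeft 𝕜 b * (dpow α * B) :=
      LinearMap.ext fun f => by simp [op_monomial]
    rw [h]
    exact mul_op_mem b (hd α hB)
  | add P Q hP hQ =>
    rw [map_add, add_mul]
    exact Submodule.add_mem _ hP hQ

/-- The exponential function `x ↦ exp(∑ tᵢ xⁱ)`. -/
def expFun (t : Fin n → ℝ) : Smooth n 𝕜 :=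
  Smooth.mk (fun x => ((Real.exp (∑ i, t i * x i) : ℝ) : 𝕜)) (by
      have h : ContDiff ℝ ∞ fun x : Fin n → ℝ => Real.exp (∑ i, t i * x i) :=
        Real.contDiff_exp.comp
          (ContDiff.sum fun i _ => contDiff_const.mul (contDiff_apply ℝ ℝ i))
      exact (RCLike.ofRealCLM (K := 𝕜)).contDiff.comp h)

theorem expFun_apply (t x : Fin n → ℝ) :
    (expFun t : Smooth n 𝕜) x = ((Real.exp (∑ i, t i * x i) : ℝ) : 𝕜) := rfl

theorem pd_expFun (t : Fin n → ℝ) (i : Fin n) :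
    pd i (expFun t) = ((t i : ℝ) : 𝕜) • (expFun t : Smooth n 𝕜) := by
  refine DFunLike.ext _ _ fun x => ?_
  have h1 : HasFDerivAt (fun x : Fin n → ℝ => ∑ j, t j * x j)
      (∑ j, t j • (ContinuousLinearMap.proj j : (Fin n → ℝ) →L[ℝ] ℝ)) x :=
    HasFDerivAt.fun_sum fun j _ =>
      (ContinuousLinearMap.proj (R := ℝ) (φ := fun _ : Fin n => ℝ) j).hasFDerivAt.const_mul (t j)
  have h2 := (RCLike.ofRealCLM (K := 𝕜)).hasFDerivAt.comp x h1.exp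
  refine Eq.trans (congrArg (fun L => L (Pi.single i 1)) h2.fderiv) ?_
  simp [expFun_apply, Pi.single_apply, mul_comm]

theorem dpow_expFun (t : Fin n → ℝ) (α : Fin n →₀ ℕ) :
    dpow α (expFun t) = (∏ i, ((t i : ℝ) : 𝕜) ^ α i) • (expFun t : Smooth n 𝕜) := by
  induction α using Finsupp.induction_linear with
  | zero => simp [dpow_zero]
  | add α β hα hβ =>
    rw [dpow_add, Module.End.mul_apply, hβ, map_smul, hα, smul_smul, ← Finset.prod_mul_distrib]
    congr 1
    exact Finset.prod_congr rfl fun i _ => by simp [pow_add, mul_comm]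
  | single i m =>
    induction m with
    | zero => simp [dpow_zero]
    | succ m ih =>
      rw [Finsupp.single_add, dpow_add, Module.End.mul_apply, dpow_single, pd_expFun, map_smul, ih,
        smul_smul]
      congr 1
      have h : ∏ j, ((t j : ℝ) : 𝕜) ^ (Finsupp.single i 1 : Fin n →₀ ℕ) j = ((t i : ℝ) : 𝕜) := by
        rw [Finset.prod_eq_single i (fun j _ hj => by simp [Finsupp.single_eq_of_ne hj])
          (by simp)]
        simp
      simp only [Finsupp.add_apply, pow_add, Finset.prod_mul_distrib]
      rw [h, mul_comm]

/-- The coefficients of a differential operator are uniquely determined. -/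
theorem op_injective : Function.Injective (op : Pol n 𝕜 →ₗ[𝕜] Module.End 𝕜 (Smooth n 𝕜)) := by
  rw [injective_iff_map_eq_zero]
  intro P hP
  have hval : ∀ (x t : Fin n → ℝ), ∑ α ∈ P.support,
      (P.coeff α : Smooth n 𝕜) x * ∏ i, ((t i : ℝ) : 𝕜) ^ α i = 0 := by
    intro x t
    have h1 : op P (expFun t : Smooth n 𝕜) = 0 := by rw [hP]; rfl
    have h2 : op P (expFun t : Smooth n 𝕜) = ∑ α ∈ P.support, P.coeff α * dpow α (expFun t : Smooth n 𝕜) := by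
      conv_lhs => rw [P.as_sum]
      rw [map_sum, LinearMap.sum_apply]
      exact Finset.sum_congr rfl fun α _ => op_monomial _ _ _
    rw [h2] at h1
    have h3 := congrArg (Smooth.eval x) h1
    simp only [dpow_expFun, map_sum, map_zero] at h3
    have hne : (expFun t : Smooth n 𝕜) x ≠ 0 := by
      simp [expFun_apply]
    refine (mul_eq_zero.mp ?_).resolve_right hne
    rw [Finset.sum_mul]
    simpa [mul_assoc, mul_left_comm] using h3
  refine MvPolynomial.ext _ _ fun α => DFunLike.ext _ _ fun x => ?_
  have h0 : MvPolynomial.map (Smooth.eval x) P = 0 := by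
    refine MvPolynomial.funext_set (fun _ => Set.range ((↑) : ℝ → 𝕜))
      (fun _ => Set.infinite_range_of_injective RCLike.ofReal_injective) fun y hy => ?_
    choose t ht using fun i => hy i (Set.mem_univ i)
    rw [MvPolynomial.eval_map, MvPolynomial.eval₂_eq', map_zero]
    simp only [← ht]
    exact hval x t
  have h4 := congrArg (MvPolynomial.coeff α) h0
  rw [MvPolynomial.coeff_map] at h4
  exact h4

/-- The identification of vector spaces `Pol(T*ℝⁿ) ≅ D_λ(ℝⁿ)` by normal ordering. -/
def normalOrdering : Pol n 𝕜 ≃ₗ[𝕜] DiffOp n 𝕜 :=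
  LinearEquiv.ofInjective op op_injective

/-- The highest order (nonzero) homogeneous component in `ξ` of a polynomial (`0` for `0`). -/
def leadingTerm (P : Pol n 𝕜) : Pol n 𝕜 :=
  MvPolynomial.homogeneousComponent P.totalDegree P

/-- The principal symbol of a differential operator `A = ∑ a_α ∂^α` of order `k`:
`∑_{|α| = k} a_α ξ^α`. -/
def principalSymbol (A : DiffOp n 𝕜) : Pol n 𝕜 :=
  leadingTerm (normalOrdering.symm A)

/-! ### Vector fields and their actions -/

/-- Vector fields `X = Xⁱ ∂ᵢ` on `ℝⁿ`, given by their components (real vector fields being those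
with real-valued components). -/
abbrev VField (n : ℕ) (𝕜 : Type*) [RCLike 𝕜] : Type _ := Fin n → Smooth n 𝕜

/-- The Lie derivative `L_X^λ φ = Xⁱ ∂ᵢ φ + λ (∂ᵢ Xⁱ) φ` on `λ`-densities. -/
def lieDensity (lam : 𝕜) (X : VField n 𝕜) : Module.End 𝕜 (Smooth n 𝕜) :=
  (∑ i, LinearMap.mulLeft 𝕜 (X i) * pd i) + lam • LinearMap.mulLeft 𝕜 (∑ i, pd i (X i))

theorem lieDensity_mem (lam : 𝕜) (X : VField n 𝕜) : lieDensity lam X ∈ DiffOp n 𝕜 := by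
  have h1 : (1 : Module.End 𝕜 (Smooth n 𝕜)) ∈ DiffOp n 𝕜 :=
    ⟨MvPolynomial.monomial 0 1, LinearMap.ext fun f => by
      rw [op_monomial, dpow_zero, one_mul]⟩
  refine Submodule.add_mem _ (Submodule.sum_mem _ fun i _ => ?_) (Submodule.smul_mem _ _ ?_)
  · simpa using mul_op_mem (X i) (pd_op_mem i h1)
  · simpa using mul_op_mem (∑ i, pd i (X i)) h1

theorem lie_mem (lam : 𝕜) (X : VField n 𝕜) {A : Module.End 𝕜 (Smooth n 𝕜)}
    (hA : A ∈ DiffOp n 𝕜) : lieDensity lam X * A - A * lieDensity lam X ∈ DiffOp n 𝕜 :=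
  have h1 : lieDensity lam X * A ∈ DiffOp n 𝕜 := comp_mem (lieDensity_mem lam X) hA
  have h2 : A * lieDensity lam X ∈ DiffOp n 𝕜 := comp_mem hA (lieDensity_mem lam X)
  (DiffOp n 𝕜).sub_mem h1 h2

/-- The action `A ↦ L_X^λ ∘ A - A ∘ L_X^λ` of a vector field on `D_λ(ℝⁿ)`. -/
def lieDiffOp (lam : 𝕜) (X : VField n 𝕜) (A : DiffOp n 𝕜) : DiffOp n 𝕜 :=
  ⟨lieDensity lam X * (A : Module.End 𝕜 (Smooth n 𝕜)) - A * lieDensity lam X, lie_mem lam X A.2⟩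

/-- The partial derivative `∂ᵢ = ∂/∂xⁱ` on `Pol(T*ℝⁿ)`, acting on coefficients. -/
def pdPol (i : Fin n) : Pol n 𝕜 →ₗ[𝕜] Pol n 𝕜 :=
  termwise fun α => (MvPolynomial.monomial α).restrictScalars 𝕜 ∘ₗ pd i

/-- The action `L_X = Xⁱ ∂ᵢ - ξⱼ (∂ᵢ Xʲ) ∂_{ξᵢ}` of a vector field on `Pol(T*ℝⁿ)`. -/
def liePol (X : VField n 𝕜) (P : Pol n 𝕜) : Pol n 𝕜 :=
  (∑ i, MvPolynomial.C (X i) * pdPol i P) -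
    ∑ i, ∑ j, MvPolynomial.X j * MvPolynomial.C (pd i (X j)) * MvPolynomial.pderiv i P

/-- The coordinate function `xⁱ`. -/
def coord (i : Fin n) : Smooth n 𝕜 :=
  Smooth.mk (fun x => ((x i : ℝ) : 𝕜)) (by
    have h : ContDiff ℝ ∞ fun x : Fin n → ℝ => x i := contDiff_apply ℝ ℝ i
    exact (RCLike.ofRealCLM (K := 𝕜)).contDiff.comp h)

/-- The projective Lie algebra `sl(n+1, ℝ)` of vector fields on `ℝⁿ`: the real linear combinations
of the fields `∂ⱼ`, `xⁱ ∂ⱼ` and `xⁱ 𝓔`, where `𝓔 = xʲ ∂ⱼ`. -/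
def projectiveAlgebra (n : ℕ) (𝕜 : Type*) [RCLike 𝕜] : Set (VField n 𝕜) :=
  {X | ∃ (a : Fin n → ℝ) (b : Fin n → Fin n → ℝ) (c : Fin n → ℝ), ∀ j,
    X j = algebraMap 𝕜 (Smooth n 𝕜) (a j : 𝕜) + (∑ i, (b i j : 𝕜) • coord i) +
      ∑ i, (c i : 𝕜) • (coord i * coord j)}

/-! ### Symbol maps -/

/-- A linear bijection `σ : D_λ → Pol(T*ℝⁿ)` is a symbol map if the highest order term of `σ(A)` is
the principal symbol of `A`, for every `A`. -/
def IsSymbolMap (σ : DiffOp n 𝕜 ≃ₗ[𝕜] Pol n 𝕜) : Prop :=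
  ∀ A : DiffOp n 𝕜, leadingTerm (σ A) = principalSymbol A

/-- `sl(n+1, ℝ)`-equivariance of a linear bijection `σ : D_λ → Pol(T*ℝⁿ)`. -/
def IsProjEquivariant (lam : 𝕜) (σ : DiffOp n 𝕜 ≃ₗ[𝕜] Pol n 𝕜) : Prop :=
  ∀ X ∈ projectiveAlgebra n 𝕜, ∀ A : DiffOp n 𝕜, σ (lieDiffOp lam X A) = liePol X (σ A)

/-- `σ` is differential: for every `k`, its restriction to the homogeneous component of degree `k`
(identified with `S^k` by normal ordering) is a differential operator. This means that its values
there have bounded degree in `ξ`, and that all its matrix entries, which map the coefficient `a` of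
`ξ^α` to a coefficient of the image of `a ξ^α`, are scalar differential operators. -/
def IsDifferential (σ : DiffOp n 𝕜 ≃ₗ[𝕜] Pol n 𝕜) : Prop :=
  ∀ k : ℕ,
    (∃ d : ℕ, ∀ P : Pol n 𝕜, P.IsHomogeneous k → (σ (normalOrdering P)).totalDegree ≤ d) ∧
    ∀ α β : Fin n →₀ ℕ, α.degree = k →
      ∃ D ∈ DiffOp n 𝕜, ∀ a : Smooth n 𝕜,
        D a = MvPolynomial.coeff β (σ (normalOrdering (MvPolynomial.monomial α a)))

/-- The operator `Div = ∂ᵢ ∂_{ξᵢ}` on `Pol(T*ℝⁿ)`. -/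
def Div (P : Pol n 𝕜) : Pol n 𝕜 :=
  ∑ i, pdPol i (MvPolynomial.pderiv i P)

/-- The divergence of symmetric contravariant tensor fields, as an operator on `Pol(T*ℝⁿ)`. It is
determined by `div = (1/k) Div` on the component `S^k` of degree `k ≥ 1`, and `div = 0` on `S^0`;
in tensor components it is `div(a)^{i₁…iₖ₋₁} = ∂ⱼ a^{i₁…iₖ₋₁j}` (proved in `div_tensorPol`). -/
def div (P : Pol n 𝕜) : Pol n 𝕜 :=
  ∑ k ∈ Finset.range (P.totalDegree + 1),
    (k : 𝕜)⁻¹ • Div (MvPolynomial.homogeneousComponent k P)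

/-- The polynomial `a^{i₁…iₖ} ξ_{i₁} ⋯ ξ_{iₖ}` of a tensor field with components `a`. -/
def tensorPol {k : ℕ} (a : (Fin k → Fin n) → Smooth n 𝕜) : Pol n 𝕜 :=
  ∑ I : Fin k → Fin n, MvPolynomial.C (a I) * ∏ m, MvPolynomial.X (I m)

theorem pdPol_tensor {k : ℕ} (i : Fin n) (a : Smooth n 𝕜) (J : Fin k → Fin n) :
    pdPol i (MvPolynomial.C a * ∏ m, MvPolynomial.X (J m)) =
      MvPolynomial.C (pd i a) * ∏ m, MvPolynomial.X (J m) := by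
  have h : ∀ b : Smooth n 𝕜, MvPolynomial.C b * ∏ m, MvPolynomial.X (J m) =
      MvPolynomial.monomial (∑ m, Finsupp.single (J m) 1) b := by
    intro b
    rw [← mul_one b, ← MvPolynomial.C_mul_monomial, mul_one, MvPolynomial.monomial_sum_one]
    rfl
  rw [h, h, pdPol, termwise_monomial]
  rfl

theorem isHomogeneous_tensorPol {k : ℕ} (a : (Fin k → Fin n) → Smooth n 𝕜) :
    (tensorPol a).IsHomogeneous k := by
  refine MvPolynomial.IsHomogeneous.sum _ _ _ fun I _ => ?_
  have h := MvPolynomial.IsHomogeneous.prod Finset.univ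
    (fun m => (MvPolynomial.X (I m) : Pol n 𝕜)) (fun _ => 1)
    (fun m _ => MvPolynomial.isHomogeneous_X _ _)
  simpa using (MvPolynomial.isHomogeneous_C (Fin n) (a I)).mul h

theorem div_of_isHomogeneous {k : ℕ} {P : Pol n 𝕜} (hP : P.IsHomogeneous k) :
    div P = (k : 𝕜)⁻¹ • Div P := by
  classical
  by_cases h0 : P = 0
  · subst h0
    simp [div, Div]
  · rw [div, hP.totalDegree h0, Finset.sum_eq_single_of_mem k (by simp)]
    · rw [MvPolynomial.homogeneousComponent_of_mem hP, if_pos rfl]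
    · intro j _ hj
      rw [MvPolynomial.homogeneousComponent_of_mem hP, if_neg hj]
      simp [Div]

theorem pderiv_prod_X {k : ℕ} (i : Fin n) (I : Fin (k + 1) → Fin n) :
    MvPolynomial.pderiv i (∏ m, MvPolynomial.X (I m) : Pol n 𝕜) =
      ∑ m, if I m = i then ∏ p : Fin k, MvPolynomial.X (I (m.succAbove p)) else 0 := by
  induction k with
  | zero =>
    rw [Fin.prod_univ_one, Fin.sum_univ_one]
    by_cases h : I 0 = i
    · rw [if_pos h, h, MvPolynomial.pderiv_X_self, Fin.prod_univ_zero]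
    · rw [if_neg h, MvPolynomial.pderiv_X_of_ne h]
  | succ k ih =>
    rw [Fin.prod_univ_succ, Derivation.leibniz, ih (fun m => I m.succ), add_comm]
    conv_rhs => rw [Fin.sum_univ_succ]
    congr 1
    · by_cases h : I 0 = i
      · simp [h]
      · simp [h, MvPolynomial.pderiv_X_of_ne h]
    · rw [smul_eq_mul, Finset.mul_sum]
      refine Finset.sum_congr rfl fun m _ => ?_
      by_cases h : I m.succ = i
      · simp [h, Fin.prod_univ_succ]
      · simp [h]

/-- In tensor components, `div(a)^{i₁…iₖ} = ∂ⱼ a^{i₁…iₖj}` for symmetric `a`. -/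
theorem div_tensorPol {k : ℕ} (a : (Fin (k + 1) → Fin n) → Smooth n 𝕜)
    (ha : ∀ (s : Equiv.Perm (Fin (k + 1))) (I : Fin (k + 1) → Fin n), a (I ∘ s) = a I) :
    div (tensorPol a) = tensorPol fun I : Fin k → Fin n => ∑ j, pd j (a (Fin.snoc I j)) := by
  have hsymm : ∀ (m : Fin (k + 1)) (j : Fin n) (J : Fin k → Fin n),
      a (m.insertNth j J) = a (Fin.snoc J j) := by
    intro m j J
    rw [← ha ((finSuccEquiv' m).trans (finSuccEquiv' (Fin.last k)).symm) (Fin.snoc J j)]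
    congr 1
    funext p
    refine Fin.succAboveCases m ?_ (fun q => ?_) p
    · simp
    · simp
  have hpd : ∀ (i : Fin n) (I : Fin (k + 1) → Fin n),
      pdPol i (MvPolynomial.pderiv i (MvPolynomial.C (a I) * ∏ m, MvPolynomial.X (I m))) =
        ∑ m, if I m = i then
          MvPolynomial.C (pd i (a I)) * ∏ p : Fin k, MvPolynomial.X (I (m.succAbove p)) else 0 := by
    intro i I
    rw [MvPolynomial.pderiv_C_mul, pderiv_prod_X, Finset.mul_sum, map_sum]
    refine Finset.sum_congr rfl fun m _ => ?_
    by_cases h : I m = i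
    · rw [if_pos h, if_pos h, pdPol_tensor]
    · rw [if_neg h, if_neg h, mul_zero, map_zero]
  rw [div_of_isHomogeneous (isHomogeneous_tensorPol a)]
  have h1 : Div (tensorPol a) = ∑ m : Fin (k + 1), ∑ I : Fin (k + 1) → Fin n,
      MvPolynomial.C (pd (I m) (a I)) * ∏ p : Fin k, MvPolynomial.X (I (m.succAbove p)) := by
    simp only [Div, tensorPol, map_sum, hpd]
    rw [Finset.sum_comm]
    rw [Finset.sum_comm (s := (Finset.univ : Finset (Fin (k + 1))))]
    refine Finset.sum_congr rfl fun I _ => ?_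
    rw [Finset.sum_comm]
    simp
  have h2 : ∀ m : Fin (k + 1), ∑ I : Fin (k + 1) → Fin n,
      MvPolynomial.C (pd (I m) (a I)) * ∏ p : Fin k, MvPolynomial.X (I (m.succAbove p)) =
        tensorPol fun I : Fin k → Fin n => ∑ j, pd j (a (Fin.snoc I j)) := by
    intro m
    rw [← (Fin.insertNthEquiv (fun _ => Fin n) m).sum_comp, Fintype.sum_prod_type, Finset.sum_comm]
    simp only [tensorPol, map_sum, Finset.sum_mul]
    refine Finset.sum_congr rfl fun J _ => Finset.sum_congr rfl fun j _ => ?_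
    have h : Fin.insertNthEquiv (fun _ => Fin n) m (j, J) = m.insertNth j J := rfl
    simp only [h, Fin.insertNth_apply_same, Fin.insertNth_apply_succAbove, hsymm]
  rw [h1, Finset.sum_congr rfl fun m _ => h2 m]
  rw [Finset.sum_const, Finset.card_univ, Fintype.card_fin, ← Nat.cast_smul_eq_nsmul 𝕜, smul_smul,
    inv_mul_cancel₀ (by exact_mod_cast Nat.succ_ne_zero k), one_smul]

/-- The generalized binomial coefficient `x (x - 1) ⋯ (x - m + 1) / m!`. -/
def genBinom (x : 𝕜) (m : ℕ) : 𝕜 :=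
  (∏ j ∈ Finset.range m, (x - j)) / (m.factorial : 𝕜)

/-- The constants `c^k_ℓ` (for `ℓ ≤ k`). -/
def symbolCoeff (n : ℕ) (lam : 𝕜) (k l : ℕ) : 𝕜 :=
  (-1) ^ (k - l) * ((k.choose l : 𝕜) * genBinom ((n + 1) * lam + k - 1) (k - l)) /
    ((k + l + n).choose (k - l) : 𝕜)

end ProjectiveSymbol

end

noncomputable section

namespace ProjectiveSymbol

variable {n : ℕ} {𝕜 : Type*} [RCLike 𝕜]

open MvPolynomial Finset

/-! Normal ordering carries both modules to `Pol`, so the task is to compare two actions there. A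
projective field `Y` has constant second derivatives, governed by a covector `c`
(`HasProjectiveHessian`). Because of this, the action on operators differs from the tensor action by
one correction only: on degree `k` it is `L_Y - ((n+1)λ + k - 1) c·∂_ξ` (`op_lieNormal`,
`euler_covectorDeriv`).

Existence: the operator `Div` fails to commute with `L_Y` by terms of the same shape. On degree `k`,
`Div^(m+1) L_Y - L_Y Div^(m+1)` is `-(m+1)(2k - m - 1 + n) c·∂_ξ Div^m` (`DivLin_pow_liePol`). A sum
of multiples of `Div^m` therefore intertwines the two actions once its coefficients satisfy a first
order recursion in `(k, m)`. The stated constants, rescaled from `div` to `Div`, solve it with value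
`1` at `m = 0` (`divCoeff_succ`, `divCoeff_zero`). The factor `2k - m - 1 + n` never vanishes in the
range used, so there are no exceptional `λ`. The map is the identity up to lower degree, hence
bijective and compatible with principal symbols.

Uniqueness: two equivariant symbol maps differ by a linear map `T` of `Pol` that commutes with every
projective `L_Y` and keeps leading terms. Then `T` commutes with the Casimir operator, which acts on
degree `k` by `2k(k+n)` (`casimir_of_isHomogeneous`). These eigenvalues are distinct, so `T`
preserves each degree, where keeping leading terms means being the identity. -/

/-! ### Calculus on `Pol`: derivatives in `x` and in `ξ`. -/

theorem pdPol_monomial (i : Fin n) (α : Fin n →₀ ℕ) (a : Smooth n 𝕜) :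
    pdPol i (monomial α a) = monomial α (pd i a) := by
  rw [pdPol, termwise_monomial]
  rfl

theorem coeff_pdPol (i : Fin n) (α : Fin n →₀ ℕ) (P : Pol n 𝕜) :
    coeff α (pdPol i P) = pd i (coeff α P) := by
  induction P using MvPolynomial.induction_on' with
  | monomial β a =>
    classical
    rw [pdPol_monomial, coeff_monomial, coeff_monomial]
    split_ifs <;> simp
  | add P Q hP hQ => rw [map_add, coeff_add, coeff_add, map_add, hP, hQ]

theorem pdPol_mul (i : Fin n) (P Q : Pol n 𝕜) :
    pdPol i (P * Q) = P * pdPol i Q + pdPol i P * Q := by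
  induction P using MvPolynomial.induction_on' with
  | monomial α a =>
    induction Q using MvPolynomial.induction_on' with
    | monomial β b =>
      simp only [monomial_mul, pdPol_monomial, pd_mul, map_add]
    | add P Q hP hQ => simp only [mul_add, map_add, hP, hQ]; ring
  | add P Q hP hQ => simp only [add_mul, map_add, hP, hQ]; ring

theorem pdPol_C (i : Fin n) (a : Smooth n 𝕜) : pdPol i (C a : Pol n 𝕜) = C (pd i a) :=
  pdPol_monomial i 0 a

theorem pd_one (i : Fin n) : pd i (1 : Smooth n 𝕜) = 0 := by
  have h := pd_mul i (1 : Smooth n 𝕜) 1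
  simpa using h

theorem pd_algebraMap (i : Fin n) (c : 𝕜) : pd i (algebraMap 𝕜 (Smooth n 𝕜) c) = 0 := by
  rw [Algebra.algebraMap_eq_smul_one, map_smul, pd_one, smul_zero]

theorem pdPol_X (i j : Fin n) : pdPol i (X j : Pol n 𝕜) = 0 := by
  rw [X, pdPol_monomial, pd_one, map_zero]

theorem pdPol_X_mul (i j : Fin n) (P : Pol n 𝕜) : pdPol i (X j * P) = X j * pdPol i P := by
  rw [pdPol_mul, pdPol_X, zero_mul, add_zero]

theorem pdPol_comm (i j : Fin n) (P : Pol n 𝕜) : pdPol i (pdPol j P) = pdPol j (pdPol i P) := by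
  ext1 α
  simp only [coeff_pdPol]
  exact LinearMap.congr_fun (pd_commute i j) _

theorem pderiv_pdPol (i j : Fin n) (P : Pol n 𝕜) :
    pderiv i (pdPol j P) = pdPol j (pderiv i P) := by
  induction P using MvPolynomial.induction_on' with
  | monomial β a =>
    rw [pdPol_monomial, pderiv_monomial, pderiv_monomial, pdPol_monomial]
    congr 1
    rw [pd_mul, ← map_natCast (algebraMap 𝕜 (Smooth n 𝕜)), pd_algebraMap, mul_zero, zero_add]
  | add P Q hP hQ => simp only [map_add, hP, hQ]

/-- The commutator of two derivations is again a derivation, so it is enough that it vanishes on the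
variables. -/
theorem pderiv_comm (i j : Fin n) (P : Pol n 𝕜) :
    pderiv i (pderiv j P) = pderiv j (pderiv i P) := by
  have h : ⁅pderiv (R := Smooth n 𝕜) i, pderiv j⁆ =
      (0 : Derivation (Smooth n 𝕜) (Pol n 𝕜) (Pol n 𝕜)) := by
    classical
    refine MvPolynomial.derivation_ext fun k => ?_
    simp [Derivation.commutator_apply, pderiv_X, Pi.single_apply, apply_ite]
  have h' := DFunLike.congr_fun h P
  rw [Derivation.commutator_apply] at h'
  exact sub_eq_zero.mp h'

theorem pderiv_smul' (i : Fin n) (c : 𝕜) (P : Pol n 𝕜) : pderiv i (c • P) = c • pderiv i P := by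
  rw [← algebraMap_smul (Smooth n 𝕜) c P, Derivation.map_smul, algebraMap_smul]

theorem pderiv_X_mul (i j : Fin n) (P : Pol n 𝕜) :
    pderiv i (X j * P) = X j * pderiv i P + if i = j then P else 0 := by
  classical
  rw [Derivation.leibniz, pderiv_X, smul_eq_mul, smul_eq_mul, Pi.single_apply]
  split_ifs <;> simp_all

theorem pdPol_C_mul (i : Fin n) (a : Smooth n 𝕜) (P : Pol n 𝕜) :
    pdPol i (C a * P) = C a * pdPol i P + C (pd i a) * P := by
  rw [pdPol_mul, pdPol_C]

theorem isHomogeneous_pdPol {k : ℕ} (i : Fin n) {P : Pol n 𝕜} (hP : P.IsHomogeneous k) :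
    (pdPol i P).IsHomogeneous k := by
  intro α hα
  refine hP fun h => hα ?_
  rw [coeff_pdPol, h, map_zero]

theorem isHomogeneous_pderiv {k : ℕ} (i : Fin n) {P : Pol n 𝕜} (hP : P.IsHomogeneous k) :
    (pderiv i P).IsHomogeneous (k - 1) := hP.pderiv

theorem isHomogeneous_smul {k : ℕ} (c : 𝕜) {P : Pol n 𝕜} (hP : P.IsHomogeneous k) :
    (c • P).IsHomogeneous k := by
  intro α hα
  refine hP fun h => hα ?_
  rw [coeff_smul, h, smul_zero]

theorem isHomogeneous_C_mul {k : ℕ} (a : Smooth n 𝕜) {P : Pol n 𝕜} (hP : P.IsHomogeneous k) :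
    (C a * P).IsHomogeneous k := by
  simpa using (isHomogeneous_C (Fin n) a).mul hP

/-! ### The operators `Div` and `L_Y` and their effect on degree. -/

/-- The operator `Div` as a linear map. -/
def DivLin : Pol n 𝕜 →ₗ[𝕜] Pol n 𝕜 :=
  ∑ i, pdPol i ∘ₗ (pderiv i).toLinearMap.restrictScalars 𝕜

theorem DivLin_apply (P : Pol n 𝕜) : DivLin P = Div P := by
  simp [DivLin, Div]

theorem DivLin_def (P : Pol n 𝕜) : DivLin P = ∑ i, pdPol i (pderiv i P) := by
  simp [DivLin]

theorem isHomogeneous_DivLin {k : ℕ} {P : Pol n 𝕜} (hP : P.IsHomogeneous k) :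
    (DivLin P).IsHomogeneous (k - 1) := by
  rw [DivLin_def]
  exact IsHomogeneous.sum _ _ _ fun i _ => isHomogeneous_pdPol i (isHomogeneous_pderiv i hP)

theorem pderiv_of_isHomogeneous_zero (i : Fin n) {P : Pol n 𝕜} (hP : P.IsHomogeneous 0) :
    pderiv i P = 0 := by
  rw [totalDegree_eq_zero_iff_eq_C.mp (Nat.le_zero.mp hP.totalDegree_le), pderiv_C]

theorem isHomogeneous_DivLin_pow {k : ℕ} {P : Pol n 𝕜} (hP : P.IsHomogeneous k) (m : ℕ) :
    ((DivLin ^ m) P).IsHomogeneous (k - m) := by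
  induction m with
  | zero => simpa using hP
  | succ m ih =>
    rw [pow_succ', Module.End.mul_apply, ← Nat.sub_sub]
    exact isHomogeneous_DivLin ih

/-- After `k` applications the degree is `0`, and one more differentiates a constant in `ξ`.
Truncated subtraction in `isHomogeneous_DivLin_pow` hides this vanishing. -/
theorem DivLin_pow_eq_zero {k m : ℕ} {P : Pol n 𝕜} (hP : P.IsHomogeneous k) (h : k < m) :
    (DivLin ^ m) P = 0 := by
  obtain ⟨r, rfl⟩ := Nat.exists_eq_add_of_lt h
  rw [show k + r + 1 = r + (1 + k) by ring, pow_add, Module.End.mul_apply, pow_add,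
    Module.End.mul_apply, pow_one, DivLin_def]
  have h0 : ((DivLin ^ k) P).IsHomogeneous 0 := by simpa using isHomogeneous_DivLin_pow hP k
  simp [pderiv_of_isHomogeneous_zero _ h0]

theorem euler_of_isHomogeneous {k : ℕ} {P : Pol n 𝕜} (hP : P.IsHomogeneous k) :
    ∑ i, X i * pderiv i P = (k : 𝕜) • P := by
  rw [hP.sum_X_mul_pderiv, Nat.cast_smul_eq_nsmul]

/-- The action of a vector field on `Pol(T*ℝⁿ)` as a linear map. -/
def liePolLin (Y : VField n 𝕜) : Pol n 𝕜 →ₗ[𝕜] Pol n 𝕜 :=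
  (∑ i, LinearMap.mulLeft 𝕜 (C (Y i)) ∘ₗ pdPol i) -
    ∑ i, ∑ j, LinearMap.mulLeft 𝕜 (X j * C (pd i (Y j))) ∘ₗ
      (pderiv i).toLinearMap.restrictScalars 𝕜

theorem liePolLin_apply (Y : VField n 𝕜) (P : Pol n 𝕜) : liePolLin Y P = liePol Y P := by
  simp [liePolLin, liePol, mul_assoc]

theorem isHomogeneous_liePol {k : ℕ} (Y : VField n 𝕜) {P : Pol n 𝕜} (hP : P.IsHomogeneous k) :
    (liePol Y P).IsHomogeneous k := by
  refine IsHomogeneous.sub (IsHomogeneous.sum _ _ _ fun i _ =>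
    isHomogeneous_C_mul _ (isHomogeneous_pdPol i hP))
    (IsHomogeneous.sum _ _ _ fun i _ => IsHomogeneous.sum _ _ _ fun j _ => ?_)
  rcases k with _ | k
  · rw [pderiv_of_isHomogeneous_zero i hP, mul_zero]
    exact isHomogeneous_zero _ _ _
  · rw [mul_assoc, add_comm k]
    exact (isHomogeneous_X _ _).mul (isHomogeneous_C_mul _ (isHomogeneous_pderiv i hP))

/-! ### The action on operators in normal order. -/

theorem op_C (a : Smooth n 𝕜) : op (C a : Pol n 𝕜) = LinearMap.mulLeft 𝕜 a :=
  LinearMap.ext fun f => by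
    rw [show (C a : Pol n 𝕜) = monomial 0 a from rfl, op_monomial, dpow_zero]
    rfl

theorem algebraMap_C_mul (a : 𝕜) (Q : Pol n 𝕜) : C (algebraMap 𝕜 (Smooth n 𝕜) a) * Q = a • Q := by
  rw [C_mul', algebraMap_smul]

/-- Coefficients stand on the left, so a factor `ξ_i` adds a derivative on the far right and no
Leibniz term appears. This allows induction on `P` one variable at a time. -/
theorem op_mul_X (i : Fin n) (P : Pol n 𝕜) : op (P * X i) = op P * pd i := by
  induction P using MvPolynomial.induction_on' with
  | monomial α b =>
    refine LinearMap.ext fun f => ?_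
    simp [X, monomial_mul, op_monomial, dpow_add, dpow_single]
  | add P Q hP hQ => rw [add_mul, map_add, map_add, add_mul, hP, hQ]

theorem pd_mul_mulLeft (i : Fin n) (f : Smooth n 𝕜) :
    pd i * LinearMap.mulLeft 𝕜 f = LinearMap.mulLeft 𝕜 f * pd i + LinearMap.mulLeft 𝕜 (pd i f) :=
  LinearMap.ext fun g => by simp [pd_mul]

/-- The Leibniz expansion of an operator composed with multiplication by `f` stops after first
derivatives of `f` when `f` is affine. It is applied to `∂_i Y^j`, which is affine for a projective
field. -/
theorem op_mul_mulLeft_of_affine (P : Pol n 𝕜) (f : Smooth n 𝕜)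
    (hf : ∀ i j, pd i (pd j f) = 0) :
    op P * LinearMap.mulLeft 𝕜 f = op (C f * P + ∑ m, C (pd m f) * pderiv m P) := by
  induction P using MvPolynomial.induction_on generalizing f with
  | C a =>
    refine LinearMap.ext fun g => ?_
    simp only [pderiv_C, mul_zero, sum_const_zero, add_zero, ← C_mul, op_C]
    simp [mul_left_comm]
  | add P Q hP hQ =>
    rw [map_add, add_mul, hP f hf, hQ f hf, ← map_add]
    congr 1
    simp only [map_add, mul_add, sum_add_distrib]
    ring
  | mul_X P i ih =>
    -- Commuting `∂_i` past `f` leaves `∂_i f`, which is again affine, so the induction hypothesis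
    -- is needed for it too.
    have h0 : ∀ j k, pd j (pd k (pd i f)) = 0 := fun j k => by rw [hf k i, map_zero]
    rw [op_mul_X, mul_assoc, pd_mul_mulLeft, mul_add, ← mul_assoc, ih f hf, ih _ h0, ← op_mul_X,
      ← map_add]
    congr 1
    simp only [hf, map_zero, zero_mul, sum_const_zero, add_zero]
    simp only [mul_comm P (X i), pderiv_X_mul, mul_add, add_mul, sum_add_distrib, sum_mul,
      mul_ite, mul_zero, sum_ite_eq', mem_univ, if_true]
    have h : ∀ m, C (pd m f) * pderiv m P * X i = C (pd m f) * (X i * pderiv m P) :=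
      fun m => by ring
    simp only [h]
    ring

/-- The second derivatives of the components of a vector field are constant, and given by a
covector `c` as for the field `c_i x^i 𝓔`. -/
def HasProjectiveHessian (Y : VField n 𝕜) (c : Fin n → 𝕜) : Prop :=
  ∀ i m j, pd i (pd m (Y j)) =
    algebraMap 𝕜 (Smooth n 𝕜) ((if i = j then c m else 0) + (if m = j then c i else 0))

/-- The derivative `c_s ∂_{ξ_s}` in the direction of a constant covector. -/
def covectorDeriv (c : Fin n → 𝕜) : Pol n 𝕜 →ₗ[𝕜] Pol n 𝕜 :=
  ∑ s, c s • (pderiv s).toLinearMap.restrictScalars 𝕜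

theorem covectorDeriv_apply (c : Fin n → 𝕜) (P : Pol n 𝕜) :
    covectorDeriv c P = ∑ s, c s • pderiv s P := by
  simp [covectorDeriv]

theorem covectorDeriv_C (c : Fin n → 𝕜) (a : Smooth n 𝕜) :
    covectorDeriv c (C a : Pol n 𝕜) = 0 := by
  simp [covectorDeriv_apply]

theorem covectorDeriv_X_mul (c : Fin n → 𝕜) (i : Fin n) (P : Pol n 𝕜) :
    covectorDeriv c (X i * P) = X i * covectorDeriv c P + c i • P := by
  simp only [covectorDeriv_apply, pderiv_X_mul]
  simp [sum_add_distrib, mul_sum]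

theorem isHomogeneous_covectorDeriv {k : ℕ} (c : Fin n → 𝕜) {P : Pol n 𝕜}
    (hP : P.IsHomogeneous k) : (covectorDeriv c P).IsHomogeneous (k - 1) := by
  rw [covectorDeriv_apply]
  exact IsHomogeneous.sum _ _ _ fun i _ => isHomogeneous_smul _ (isHomogeneous_pderiv i hP)

/-- The Euler operator `ξ_j ∂_{ξ_j}`. -/
def euler : Pol n 𝕜 →ₗ[𝕜] Pol n 𝕜 :=
  ∑ j, LinearMap.mulLeft 𝕜 (X j) ∘ₗ (pderiv j).toLinearMap.restrictScalars 𝕜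

theorem euler_apply (P : Pol n 𝕜) : euler P = ∑ j, X j * pderiv j P := by
  simp [euler]

theorem euler_X_mul (i : Fin n) (P : Pol n 𝕜) : euler (X i * P) = X i * euler P + X i * P := by
  simp only [euler_apply, pderiv_X_mul]
  simp [sum_add_distrib, mul_sum, mul_add, mul_left_comm]

theorem liePol_C (Y : VField n 𝕜) (a : Smooth n 𝕜) :
    liePol Y (C a) = C (∑ i, Y i * pd i a) := by
  simp [liePol, pdPol_C]

theorem liePol_X_mul (Y : VField n 𝕜) (i : Fin n) (P : Pol n 𝕜) :
    liePol Y (X i * P) = X i * liePol Y P - (∑ j, X j * C (pd i (Y j))) * P := by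
  simp only [liePol, pdPol_X_mul, pderiv_X_mul, mul_add, sum_add_distrib, mul_sub, mul_sum,
    sum_mul, mul_ite, mul_zero, sum_ite_irrel, sum_const_zero, sum_ite_eq', mem_univ, if_true,
    mul_left_comm (X i)]
  ring

/-- The action of a projective vector field on differential operators, in terms of normally ordered
polynomials. -/
def lieNormal (lam : 𝕜) (Y : VField n 𝕜) (c : Fin n → 𝕜) : Pol n 𝕜 →ₗ[𝕜] Pol n 𝕜 :=
  liePolLin Y - (((n : 𝕜) + 1) * lam) • covectorDeriv c - euler ∘ₗ covectorDeriv c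

theorem lieNormal_apply (lam : 𝕜) (Y : VField n 𝕜) (c : Fin n → 𝕜) (P : Pol n 𝕜) :
    lieNormal lam Y c P = liePol Y P - (((n : 𝕜) + 1) * lam) • covectorDeriv c P -
      euler (covectorDeriv c P) := by
  simp [lieNormal, liePolLin_apply]

/-- Trace of the Hessian: `δ_ij c_j` sums to `c_i`, and `δ_jj c_i` to `n c_i`. -/
theorem HasProjectiveHessian.pd_divergence {Y : VField n 𝕜} {c : Fin n → 𝕜}
    (h : HasProjectiveHessian Y c) (i : Fin n) :
    pd i (∑ j, pd j (Y j)) = algebraMap 𝕜 (Smooth n 𝕜) (((n : 𝕜) + 1) * c i) := by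
  rw [map_sum, sum_congr rfl fun j _ => h i j j, ← map_sum]
  congr 1
  simp [sum_add_distrib]
  ring

theorem lieDensity_pd (lam : 𝕜) {Y : VField n 𝕜} {c : Fin n → 𝕜}
    (h : HasProjectiveHessian Y c) (i : Fin n) :
    lieDensity lam Y * pd i = pd i * lieDensity lam Y -
      (∑ j, LinearMap.mulLeft 𝕜 (pd i (Y j)) * pd j) - (((n : 𝕜) + 1) * lam * c i) • 1 := by
  refine LinearMap.ext fun f => ?_
  have h1 : ∀ j, pd i (pd j f) = pd j (pd i f) := fun j => LinearMap.congr_fun (pd_commute i j) f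
  simp only [lieDensity, LinearMap.sub_apply, Module.End.mul_apply, LinearMap.add_apply,
    LinearMap.sum_apply, LinearMap.smul_apply, LinearMap.mulLeft_apply, Module.End.one_apply,
    map_add, map_smul, pd_mul, h.pd_divergence]
  simp only [map_sum, pd_mul, h1, sum_add_distrib]
  rw [← Algebra.smul_def, smul_add, smul_smul]
  module

/-- Induction on `P` through right multiplication by `ξ_i`. The density weight enters only through
the derivative of the divergence, which gives the `(n+1)λ` term; the Euler term comes from moving
`∂_i Y^j` to the left of `op P`. -/
theorem op_lieNormal (lam : 𝕜) {Y : VField n 𝕜} {c : Fin n → 𝕜}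
    (h : HasProjectiveHessian Y c) (P : Pol n 𝕜) :
    lieDensity lam Y * op P - op P * lieDensity lam Y = op (lieNormal lam Y c P) := by
  induction P using MvPolynomial.induction_on with
  | C a =>
    rw [lieNormal_apply, covectorDeriv_C, smul_zero, map_zero, sub_zero, sub_zero, liePol_C, op_C,
      op_C]
    refine LinearMap.ext fun f => ?_
    simp only [lieDensity, LinearMap.sub_apply, Module.End.mul_apply, LinearMap.add_apply,
      LinearMap.sum_apply, LinearMap.smul_apply, LinearMap.mulLeft_apply, pd_mul, mul_add,
      sum_add_distrib, mul_sum, sum_mul, mul_smul_comm, smul_sum]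
    simp only [mul_left_comm a, mul_assoc]
    abel
  | add P Q hP hQ =>
    rw [map_add, map_add, map_add, ← hP, ← hQ]
    noncomm_ring
  | mul_X P i ih =>
    -- The bracket is a derivation of composition; the bracket with `∂_i` comes from
    -- `lieDensity_pd`.
    have e1 : lieDensity lam Y * op (P * X i) - op (P * X i) * lieDensity lam Y =
        (lieDensity lam Y * op P - op P * lieDensity lam Y) * pd i -
          ((∑ j, op P * LinearMap.mulLeft 𝕜 (pd i (Y j)) * pd j) +
            (((n : 𝕜) + 1) * lam * c i) • op P) := by
      rw [op_mul_X, sub_mul, mul_assoc (op P) _ (pd i), lieDensity_pd lam h]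
      simp only [mul_sub, mul_sum, mul_smul_comm, mul_one, mul_assoc]
      abel
    have e2 : ∀ j, op P * LinearMap.mulLeft 𝕜 (pd i (Y j)) * pd j =
        op ((C (pd i (Y j)) * P + ∑ m, C (pd m (pd i (Y j))) * pderiv m P) * X j) := by
      intro j
      rw [op_mul_X, op_mul_mulLeft_of_affine]
      intro k l
      rw [h l i j, pd_algebraMap]
    rw [e1, ih, ← op_mul_X]
    simp only [e2]
    rw [← map_sum, ← map_smul, ← map_add, ← map_sub]
    congr 1
    -- The two Kronecker terms of the Hessian give one summand each; together they match the
    -- difference between `euler (c·∂_ξ (ξ_i P))` and `ξ_i euler (c·∂_ξ P)`.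
    have e3 : ∑ j, (∑ m, C (pd m (pd i (Y j))) * pderiv m P) * X j =
        X i * covectorDeriv c P + c i • euler P := by
      simp only [h _ _ _, algebraMap_C_mul, add_smul, ite_smul, zero_smul, sum_add_distrib, sum_ite_eq,
        sum_ite_eq', mem_univ, if_true, add_mul, sum_mul, ite_mul, zero_mul,
        sum_ite_irrel, sum_const_zero,
        covectorDeriv_apply, euler_apply, mul_sum, smul_sum]
      rw [add_comm]
      simp only [smul_mul_assoc, mul_comm (X _)]
    simp only [add_mul, sum_add_distrib]
    rw [e3, mul_comm P (X i)]
    simp only [lieNormal_apply, liePol_X_mul, covectorDeriv_X_mul, map_add, map_smul, euler_X_mul]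
    have e4 : ∑ j, C (pd i (Y j)) * P * X j = (∑ j, X j * C (pd i (Y j))) * P := by
      rw [sum_mul]
      exact sum_congr rfl fun j _ => by ring
    rw [e4, sub_mul, sub_mul, smul_mul_assoc, mul_comm (liePol Y P), mul_comm (covectorDeriv c P),
      mul_comm (euler _) (X i), smul_add, smul_smul]
    module

/-! ### Commutators of `L_Y` with powers of `Div`. -/

theorem pderiv_liePol (Y : VField n 𝕜) (m : Fin n) (P : Pol n 𝕜) :
    pderiv m (liePol Y P) = liePol Y (pderiv m P) - ∑ i, C (pd i (Y m)) * pderiv i P := by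
  simp only [liePol, map_sub, map_sum, pderiv_C_mul, pderiv_pdPol, mul_assoc, pderiv_X_mul,
    pderiv_comm m, sum_add_distrib, sum_ite_eq, mem_univ, if_true]
  abel

theorem pdPol_liePol (Y : VField n 𝕜) (m : Fin n) (P : Pol n 𝕜) :
    pdPol m (liePol Y P) = liePol Y (pdPol m P) + ∑ j, C (pd m (Y j)) * pdPol j P -
      ∑ i, ∑ j, X j * C (pd m (pd i (Y j))) * pderiv i P := by
  simp only [liePol, map_sub, map_sum, pdPol_C_mul, mul_assoc, pdPol_X_mul, pdPol_comm m,
    pderiv_pdPol, sum_add_distrib, mul_add]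
  abel

/-- The first derivatives of `Y` cancel because `Div` contracts an upper with a lower index; only
the Hessian survives. -/
theorem DivLin_liePol {Y : VField n 𝕜} {c : Fin n → 𝕜} (h : HasProjectiveHessian Y c)
    (P : Pol n 𝕜) :
    DivLin (liePol Y P) = liePol Y (DivLin P) - ((n : 𝕜) + 1) • covectorDeriv c P -
      (2 : 𝕜) • euler (covectorDeriv c P) := by
  -- The Hessian trace gives `n + 1`; below, in `h2`, its two symmetric summands contribute equally,
  -- whence the factor `2`.
  have h1 : ∑ m, ∑ i, C (pd m (pd i (Y m))) * pderiv i P =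
      ((n : 𝕜) + 1) • covectorDeriv c P := by
    rw [sum_comm, covectorDeriv_apply, smul_sum]
    refine sum_congr rfl fun i _ => ?_
    rw [← sum_mul, ← map_sum, sum_congr rfl fun m _ => h m i m, ← map_sum, algebraMap_C_mul,
      smul_smul]
    congr 1
    simp [sum_add_distrib]
    ring
  have h2 : ∑ m, ∑ i, ∑ j, X j * C (pd m (pd i (Y j))) * pderiv i (pderiv m P) =
      (2 : 𝕜) • euler (covectorDeriv c P) := by
    have h3 : ∀ m i j, X j * C (pd m (pd i (Y j))) * pderiv i (pderiv m P) =
        (if m = j then c i • (X j * pderiv i (pderiv m P)) else 0) +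
        (if i = j then c m • (X j * pderiv i (pderiv m P)) else 0) := by
      intro m i j
      rw [h m i j, mul_assoc, algebraMap_C_mul, add_smul, mul_add]
      split_ifs <;> simp
    simp only [h3, sum_add_distrib, sum_ite_eq, mem_univ, if_true, euler_apply,
      covectorDeriv_apply, map_sum, pderiv_smul', mul_smul_comm]
    rw [sum_comm (f := fun m i => c m • (X i * pderiv i (pderiv m P))), two_smul]
    simp only [pderiv_comm]
  have h4 : ∀ Q : Pol n 𝕜, liePol Y Q = liePolLin Y Q := fun Q => (liePolLin_apply Y Q).symm
  rw [← h1, ← h2]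
  simp only [DivLin_def, pderiv_liePol, map_sub, pdPol_liePol, map_sum, pdPol_C_mul]
  rw [h4 (∑ m, _), map_sum]
  simp only [← h4, sum_add_distrib, sum_sub_distrib]
  rw [sum_comm (f := fun m j => C (pd m (Y j)) * pdPol j (pderiv m P))]
  abel

theorem euler_eq_smul {k : ℕ} {P : Pol n 𝕜} (hP : P.IsHomogeneous k) :
    euler P = (k : 𝕜) • P := by
  rw [euler_apply, euler_of_isHomogeneous hP]

theorem covectorDeriv_of_isHomogeneous_zero (c : Fin n → 𝕜) {P : Pol n 𝕜}
    (hP : P.IsHomogeneous 0) : covectorDeriv c P = 0 := by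
  simp [covectorDeriv_apply, pderiv_of_isHomogeneous_zero _ hP]

/-- The coefficient `k - 1` lives in the field, where it is `-1` for `k = 0`; both sides are then
zero. -/
theorem euler_covectorDeriv {k : ℕ} (c : Fin n → 𝕜) {P : Pol n 𝕜} (hP : P.IsHomogeneous k) :
    euler (covectorDeriv c P) = ((k : 𝕜) - 1) • covectorDeriv c P := by
  rcases k with _ | k
  · rw [covectorDeriv_of_isHomogeneous_zero c hP, map_zero, smul_zero]
  · rw [euler_eq_smul (isHomogeneous_covectorDeriv c hP)]
    simp

theorem euler_covectorDeriv_DivLin_pow {k : ℕ} (c : Fin n → 𝕜) {P : Pol n 𝕜}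
    (hP : P.IsHomogeneous k) (m : ℕ) :
    euler (covectorDeriv c ((DivLin ^ m) P)) =
      ((k : 𝕜) - m - 1) • covectorDeriv c ((DivLin ^ m) P) := by
  by_cases h : k < m
  · simp [DivLin_pow_eq_zero hP h]
  · rw [euler_covectorDeriv c (isHomogeneous_DivLin_pow hP m), Nat.cast_sub (not_lt.mp h)]

theorem DivLin_covectorDeriv (c : Fin n → 𝕜) (P : Pol n 𝕜) :
    DivLin (covectorDeriv c P) = covectorDeriv c (DivLin P) := by
  simp only [DivLin_def, covectorDeriv_apply, map_sum, map_smul, pderiv_pdPol, smul_sum]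
  rw [sum_comm]
  simp only [pderiv_comm]

theorem DivLin_pow_covectorDeriv (c : Fin n → 𝕜) (P : Pol n 𝕜) (m : ℕ) :
    (DivLin ^ m) (covectorDeriv c P) = covectorDeriv c ((DivLin ^ m) P) := by
  induction m with
  | zero => simp
  | succ m ih => rw [pow_succ', Module.End.mul_apply, Module.End.mul_apply, ih, DivLin_covectorDeriv]

/-- `Div` commutes with `c·∂_ξ`, so the defects add up: the one at degree `k - i` is `2(k - i) + n -
1`, and summing over `i = 0, …, m` gives the coefficient. -/
theorem DivLin_pow_liePol {Y : VField n 𝕜} {c : Fin n → 𝕜} (h : HasProjectiveHessian Y c)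
    {k : ℕ} {P : Pol n 𝕜} (hP : P.IsHomogeneous k) (m : ℕ) :
    (DivLin ^ (m + 1)) (liePol Y P) = liePol Y ((DivLin ^ (m + 1)) P) -
      (((m : 𝕜) + 1) * (2 * k - m - 1 + n)) • covectorDeriv c ((DivLin ^ m) P) := by
  induction m with
  | zero =>
    rw [zero_add, pow_one, DivLin_liePol h, euler_covectorDeriv c hP]
    simp only [pow_zero, Module.End.one_apply, Nat.cast_zero]
    module
  | succ m ih =>
    have hs : ∀ (r : ℕ) (Q : Pol n 𝕜), (DivLin ^ (r + 1)) Q = DivLin ((DivLin ^ r) Q) :=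
      fun r Q => by rw [pow_succ', Module.End.mul_apply]
    rw [hs (m + 1), ih, map_sub, map_smul, DivLin_liePol h,
      euler_covectorDeriv_DivLin_pow c hP, DivLin_covectorDeriv, ← hs, ← hs]
    push_cast
    module

/-! ### The coefficients and the intertwining map. -/

/-- The coefficient of `Div^m` in the restriction of the symbol map to the component of
degree `k`. -/
def divCoeff (n : ℕ) (lam : 𝕜) (k m : ℕ) : 𝕜 :=
  symbolCoeff n lam k (k - m) * (((k - m).factorial : 𝕜) / (k.factorial : 𝕜))

/-- Setting `k = m + r` removes truncated subtraction, and the factorials of `m + r` and `r` cancel.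
-/
theorem divCoeff_add (n : ℕ) (lam : 𝕜) (m r : ℕ) :
    divCoeff n lam (m + r) m =
      (-1) ^ m * (∏ j ∈ range m, (((n : 𝕜) + 1) * lam + ((m + r : ℕ) : 𝕜) - 1 - j)) /
        (m.factorial : 𝕜) * (((2 * r + n).factorial : 𝕜) / ((m + (2 * r + n)).factorial : 𝕜)) := by
  have h1 : ((m + r).choose r : 𝕜) = ((m + r).factorial : 𝕜) / (m.factorial * r.factorial) := by
    rw [← Nat.choose_symm_add, Nat.cast_add_choose]
  have h2 : ((m + (2 * r + n)).choose m : 𝕜) =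
      ((m + (2 * r + n)).factorial : 𝕜) / (m.factorial * (2 * r + n).factorial) :=
    Nat.cast_add_choose 𝕜
  have hf : ∀ a : ℕ, (a.factorial : 𝕜) ≠ 0 := fun a => by exact_mod_cast a.factorial_ne_zero
  have e1 : m + r - m = r := by omega
  have e2 : m + r - r = m := by omega
  have e3 : m + r + r + n = m + (2 * r + n) := by ring
  rw [divCoeff, symbolCoeff, e1, e2, e3, genBinom, h1, h2]
  have := hf m; have := hf r; have := hf (m + r); have := hf (2 * r + n)
  have := hf (m + (2 * r + n))
  field_simp

theorem divCoeff_zero (n : ℕ) (lam : 𝕜) (k : ℕ) : divCoeff n lam k 0 = 1 := by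
  have h := divCoeff_add n lam 0 k
  have hf : ((2 * k + n).factorial : 𝕜) ≠ 0 := by exact_mod_cast Nat.factorial_ne_zero _
  simpa [hf] using h

/-- This is what equality of the `c·∂_ξ Div^m` terms demands: the left factor is the commutator
defect in degree `k + 1`, the right one the correction in `lieNormal` in that degree. -/
theorem divCoeff_succ (n : ℕ) (lam : 𝕜) {k m : ℕ} (h : m ≤ k) :
    divCoeff n lam (k + 1) (m + 1) * (((m : 𝕜) + 1) * (2 * ((k + 1 : ℕ) : 𝕜) - m - 1 + n)) =
      -((((n : 𝕜) + 1) * lam + k) * divCoeff n lam k m) := by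
  obtain ⟨r, rfl⟩ := Nat.exists_eq_add_of_le h
  have hf : ∀ a : ℕ, (a.factorial : 𝕜) ≠ 0 := fun a => by exact_mod_cast a.factorial_ne_zero
  rw [divCoeff_add, show m + r + 1 = (m + 1) + r by ring, divCoeff_add, prod_range_succ',
    show m + 1 + (2 * r + n) = (m + (2 * r + n)) + 1 by ring, Nat.factorial_succ,
    Nat.factorial_succ]
  -- Shifting `j` identifies the remaining factors with those for `(k, m)`; the split-off factor `j
  -- = 0` is `(n+1)λ + k`.
  have e : ∀ j : ℕ, ((n : 𝕜) + 1) * lam + ((m + 1 + r : ℕ) : 𝕜) - 1 - ((j + 1 : ℕ) : 𝕜) =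
      ((n : 𝕜) + 1) * lam + ((m + r : ℕ) : 𝕜) - 1 - j := by
    intro j; push_cast; ring
  simp only [e]
  generalize ∏ j ∈ range m, (((n : 𝕜) + 1) * lam + ((m + r : ℕ) : 𝕜) - 1 - j) = p
  have := hf m; have := hf (m + (2 * r + n))
  have h1 : (m : 𝕜) + 1 ≠ 0 := by exact_mod_cast m.succ_ne_zero
  have h2 : (m : 𝕜) + (2 * r + n) + 1 ≠ 0 := by exact_mod_cast (m + (2 * r + n)).succ_ne_zero
  push_cast
  have h3 : (2 * ((m : 𝕜) + 1 + r) - m - 1 + n) = m + (2 * r + n) + 1 := by ring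
  rw [h3]
  generalize (m : 𝕜) + (2 * r + n) = N at h2 ⊢
  field_simp
  ring

/-- The projectively equivariant symbol map on normally ordered polynomials. -/
def symbolPol (lam : 𝕜) : Pol n 𝕜 →ₗ[𝕜] Pol n 𝕜 :=
  termwise fun α => ∑ m ∈ range (α.degree + 1),
    divCoeff n lam α.degree m • (DivLin ^ m) ∘ₗ (monomial α).restrictScalars 𝕜

theorem symbolPol_of_isHomogeneous (lam : 𝕜) {k : ℕ} {P : Pol n 𝕜} (hP : P.IsHomogeneous k) :
    symbolPol lam P = ∑ m ∈ range (k + 1), divCoeff n lam k m • (DivLin ^ m) P := by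
  conv_lhs => rw [P.as_sum]
  conv_rhs => rw [P.as_sum]
  simp only [map_sum, smul_sum]
  rw [sum_comm]
  refine sum_congr rfl fun α hα => ?_
  have hd : α.degree = k := by
    rw [Finsupp.degree_eq_weight_one]
    exact hP (mem_support_iff.mp hα)
  rw [symbolPol, termwise_monomial, hd]
  simp

theorem symbolPol_lieNormal (lam : 𝕜) {Y : VField n 𝕜} {c : Fin n → 𝕜}
    (h : HasProjectiveHessian Y c) (P : Pol n 𝕜) :
    symbolPol lam (lieNormal lam Y c P) = liePol Y (symbolPol lam P) := by
  suffices H : ∀ (k : ℕ) (P : Pol n 𝕜), P.IsHomogeneous k →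
      symbolPol lam (lieNormal lam Y c P) = liePol Y (symbolPol lam P) by
    induction P using MvPolynomial.induction_on' with
    | monomial α a => exact H _ _ (isHomogeneous_monomial a rfl)
    | add P Q hP hQ =>
      rw [map_add, map_add, hP, hQ, map_add, ← liePolLin_apply, ← liePolLin_apply,
        ← liePolLin_apply, map_add]
  intro k P hP
  rw [lieNormal_apply, euler_covectorDeriv c hP, map_sub, map_sub, map_smul, map_smul,
    symbolPol_of_isHomogeneous lam (isHomogeneous_liePol Y hP),
    ← liePolLin_apply Y (symbolPol lam P), symbolPol_of_isHomogeneous lam hP, map_sum]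
  simp only [map_smul, liePolLin_apply]
  rcases k with _ | k
  · simp [covectorDeriv_of_isHomogeneous_zero c hP]
  · rw [symbolPol_of_isHomogeneous lam (isHomogeneous_covectorDeriv c hP), Nat.add_sub_cancel,
      sum_range_succ' _ (k + 1), sum_range_succ' _ (k + 1)]
    simp only [DivLin_pow_liePol h hP, DivLin_pow_covectorDeriv, smul_sub, sum_sub_distrib,
      smul_smul]
    -- Since `c·∂_ξ P` has degree `k`, the coefficients for `k` meet those for `k + 1`, as the
    -- recursion requires.
    have e : ∑ m ∈ range (k + 1), (divCoeff n lam (k + 1) (m + 1) *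
        (((m : 𝕜) + 1) * (2 * ((k + 1 : ℕ) : 𝕜) - m - 1 + n))) •
          covectorDeriv c ((DivLin ^ m) P) =
        -((((n : 𝕜) + 1) * lam + k) •
          ∑ m ∈ range (k + 1), divCoeff n lam k m • covectorDeriv c ((DivLin ^ m) P)) := by
      rw [smul_sum, ← sum_neg_distrib]
      refine sum_congr rfl fun m hm => ?_
      rw [divCoeff_succ n lam (Nat.lt_succ_iff.mp (mem_range.mp hm)), smul_smul, neg_smul]
    rw [e]
    simp only [pow_zero, Module.End.one_apply]
    push_cast
    module

/-! ### Triangularity: principal symbols and bijectivity. -/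

theorem totalDegree_symbolPol_sub_of_isHomogeneous (lam : 𝕜) {k : ℕ} {P : Pol n 𝕜}
    (hP : P.IsHomogeneous k) : (symbolPol lam P - P).totalDegree ≤ k - 1 := by
  rw [symbolPol_of_isHomogeneous lam hP, sum_range_succ', divCoeff_zero, pow_zero,
    Module.End.one_apply, one_smul, add_sub_cancel_right]
  refine totalDegree_finsetSum_le fun m _ => (totalDegree_smul_le _ _).trans ?_
  exact (isHomogeneous_DivLin_pow hP (m + 1)).totalDegree_le.trans (by omega)

theorem symbolPol_of_isHomogeneous_zero (lam : 𝕜) {P : Pol n 𝕜}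
    (hP : P.IsHomogeneous 0) : symbolPol lam P = P := by
  rw [symbolPol_of_isHomogeneous lam hP]
  simp [divCoeff_zero]

theorem symbolPol_of_totalDegree_eq_zero (lam : 𝕜) {P : Pol n 𝕜} (hP : P.totalDegree = 0) :
    symbolPol lam P = P := by
  refine symbolPol_of_isHomogeneous_zero lam ?_
  rw [totalDegree_eq_zero_iff_eq_C.mp hP]
  exact isHomogeneous_C _ _

theorem totalDegree_symbolPol_sub_lt (lam : 𝕜) {P : Pol n 𝕜} (hP : P.totalDegree ≠ 0) :
    (symbolPol lam P - P).totalDegree < P.totalDegree := by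
  have h : symbolPol lam P - P = ∑ i ∈ range (P.totalDegree + 1),
      (symbolPol lam (homogeneousComponent i P) - homogeneousComponent i P) := by
    rw [sum_sub_distrib, ← map_sum, sum_homogeneousComponent]
  refine Nat.lt_of_le_pred (Nat.pos_of_ne_zero hP) ?_
  rw [h]
  refine totalDegree_finsetSum_le fun i hi => ?_
  refine (totalDegree_symbolPol_sub_of_isHomogeneous lam
    (homogeneousComponent_isHomogeneous i P)).trans ?_
  exact Nat.sub_le_sub_right (Nat.lt_succ_iff.mp (mem_range.mp hi)) 1

theorem leadingTerm_symbolPol (lam : 𝕜) (P : Pol n 𝕜) :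
    leadingTerm (symbolPol lam P) = leadingTerm P := by
  by_cases hP : P.totalDegree = 0
  · rw [symbolPol_of_totalDegree_eq_zero lam hP]
  · have h := totalDegree_symbolPol_sub_lt lam hP
    have h1 : symbolPol lam P = P + (symbolPol lam P - P) := by ring
    rw [h1, leadingTerm, totalDegree_add_eq_left_of_totalDegree_lt h, map_add,
      homogeneousComponent_eq_zero _ _ h, add_zero, leadingTerm]

theorem symbolPol_bijective (lam : 𝕜) : Function.Bijective (symbolPol (n := n) lam) := by
  constructor
  · rw [injective_iff_map_eq_zero]
    intro P hP
    by_cases h : P.totalDegree = 0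
    · rwa [symbolPol_of_totalDegree_eq_zero lam h] at hP
    · have h1 := totalDegree_symbolPol_sub_lt lam h
      rw [hP, zero_sub, totalDegree_neg] at h1
      exact absurd h1 (lt_irrefl _)
  · intro P
    induction hd : P.totalDegree using Nat.strong_induction_on generalizing P with
    | _ d ih =>
      by_cases h : P.totalDegree = 0
      · exact ⟨P, symbolPol_of_totalDegree_eq_zero lam h⟩
      · obtain ⟨Q, hQ⟩ := ih _ (hd ▸ totalDegree_symbolPol_sub_lt lam h) _ rfl
        -- `Q` is a preimage of the lower-degree error `symbolPol lam P - P`.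
        exact ⟨P - Q, by rw [map_sub, hQ]; ring⟩

/-! ### Second derivatives of projective fields. -/

theorem pd_coord (i j : Fin n) :
    pd i (coord j : Smooth n 𝕜) = algebraMap 𝕜 (Smooth n 𝕜) (if i = j then 1 else 0) := by
  refine DFunLike.ext _ _ fun x => ?_
  have h := (RCLike.ofRealCLM (K := 𝕜)).hasFDerivAt.comp x
    (ContinuousLinearMap.proj (R := ℝ) (φ := fun _ : Fin n => ℝ) j).hasFDerivAt
  refine Eq.trans (congrArg (fun L => L (Pi.single i 1)) h.fderiv) ?_
  rw [Algebra.algebraMap_eq_smul_one, Smooth.smul_apply]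
  change _ = _ * (1 : 𝕜)
  by_cases hij : i = j
  · simp [hij]
  · simp [hij, Ne.symm hij]

theorem pd_pd_coord_mul_coord (i m s j : Fin n) :
    pd i (pd m (coord s * coord j : Smooth n 𝕜)) = algebraMap 𝕜 (Smooth n 𝕜)
      ((if i = s then if m = j then 1 else 0 else 0) +
        (if m = s then if i = j then 1 else 0 else 0)) := by
  simp only [pd_mul, map_add, pd_coord, pd_algebraMap, mul_zero, zero_add, zero_mul, add_zero]
  rw [← map_mul, ← map_mul]
  simp only [ite_mul, one_mul, zero_mul]

/-- Affine terms have no second derivatives, so `c` is read off from the coefficients of `x^i 𝓔`. -/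
theorem hasProjectiveHessian_of_mem {Y : VField n 𝕜} (hY : Y ∈ projectiveAlgebra n 𝕜) :
    ∃ c : Fin n → 𝕜, HasProjectiveHessian Y c := by
  obtain ⟨a, b, c, h⟩ := hY
  refine ⟨fun i => (c i : 𝕜), fun i m j => ?_⟩
  rw [h j]
  simp only [map_add, map_sum, map_smul, pd_algebraMap, pd_coord, smul_zero,
    sum_const_zero, zero_add, pd_pd_coord_mul_coord]
  simp only [Algebra.smul_def, ← (algebraMap 𝕜 (Smooth n 𝕜)).map_add,
    ← (algebraMap 𝕜 (Smooth n 𝕜)).map_mul]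
  rw [← map_sum]
  congr 1
  simp only [mul_add, sum_add_distrib, mul_ite, mul_one, mul_zero, sum_ite_eq, mem_univ, if_true]
  exact add_comm _ _

/-! ### Differentiality. -/

/-- A family of polynomials depending linearly on a smooth function, the coefficients being
differential operators. -/
def IsDiffFamily (F : Smooth n 𝕜 → Pol n 𝕜) : Prop :=
  ∀ β : Fin n →₀ ℕ, ∃ D ∈ DiffOp n 𝕜, ∀ a, D a = coeff β (F a)

theorem isDiffFamily_monomial (α : Fin n →₀ ℕ) :
    IsDiffFamily fun a : Smooth n 𝕜 => monomial α a := by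
  classical
  intro β
  by_cases h : α = β
  · refine ⟨op (C 1), ⟨_, rfl⟩, fun a => ?_⟩
    rw [op_C, coeff_monomial, if_pos h, LinearMap.mulLeft_apply, one_mul]
  · exact ⟨0, zero_mem _, fun a => by rw [coeff_monomial, if_neg h]; rfl⟩

theorem IsDiffFamily.sum {ι : Type*} {s : Finset ι} {F : ι → Smooth n 𝕜 → Pol n 𝕜}
    (h : ∀ i ∈ s, IsDiffFamily (F i)) : IsDiffFamily fun a => ∑ i ∈ s, F i a := by
  classical
  intro β
  choose! D hD hDa using fun i hi => h i hi β
  refine ⟨∑ i ∈ s, D i, sum_mem hD, fun a => ?_⟩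
  rw [LinearMap.sum_apply, coeff_sum]
  exact sum_congr rfl fun i hi => hDa i hi a

theorem IsDiffFamily.smul {F : Smooth n 𝕜 → Pol n 𝕜} (h : IsDiffFamily F) (c : 𝕜) :
    IsDiffFamily fun a => c • F a := by
  intro β
  obtain ⟨D, hD, hDa⟩ := h β
  exact ⟨c • D, Submodule.smul_mem _ _ hD, fun a => by rw [coeff_smul, ← hDa]; rfl⟩

theorem IsDiffFamily.DivLin {F : Smooth n 𝕜 → Pol n 𝕜} (h : IsDiffFamily F) :
    IsDiffFamily fun a => DivLin (F a) := by
  simp only [DivLin_def]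
  refine IsDiffFamily.sum fun i _ β => ?_
  obtain ⟨D, hD, hDa⟩ := h (β + Finsupp.single i 1)
  -- Differentiating in `ξ_i` brings the coefficient at `β + e_i` to `β` with factor `β_i + 1`.
  refine ⟨pd i * (((β i : 𝕜) + 1) • D), pd_op_mem i (Submodule.smul_mem _ _ hD), fun a => ?_⟩
  rw [coeff_pdPol, coeff_pderiv, ← hDa, Module.End.mul_apply, LinearMap.smul_apply,
    Algebra.smul_def, mul_comm]
  simp

theorem IsDiffFamily.DivLin_pow {F : Smooth n 𝕜 → Pol n 𝕜} (h : IsDiffFamily F) (m : ℕ) :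
    IsDiffFamily fun a => (ProjectiveSymbol.DivLin ^ m) (F a) := by
  induction m with
  | zero => simpa using h
  | succ m ih =>
    simp only [pow_succ', Module.End.mul_apply]
    exact ih.DivLin

theorem isDiffFamily_symbolPol (lam : 𝕜) (α : Fin n →₀ ℕ) :
    IsDiffFamily fun a => symbolPol lam (monomial α a) := by
  simp only [symbolPol_of_isHomogeneous lam (isHomogeneous_monomial _ rfl)]
  exact IsDiffFamily.sum fun m _ => ((isDiffFamily_monomial α).DivLin_pow m).smul _

theorem totalDegree_symbolPol_le (lam : 𝕜) {k : ℕ} {P : Pol n 𝕜}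
    (hP : P.IsHomogeneous k) : (symbolPol lam P).totalDegree ≤ k := by
  rw [symbolPol_of_isHomogeneous lam hP]
  refine totalDegree_finsetSum_le fun m _ => (totalDegree_smul_le _ _).trans ?_
  exact (isHomogeneous_DivLin_pow hP m).totalDegree_le.trans (Nat.sub_le _ _)

/-! ### From `Div` to the normalized divergence. -/

/-- The normalizations `1/k, 1/(k-1), …` multiply up; `m ≤ k` keeps the inverse of zero out of the
product. -/
theorem div_iterate {k m : ℕ} (hm : m ≤ k) {P : Pol n 𝕜} (hP : P.IsHomogeneous k) :
    div^[m] P = (((k - m).factorial : 𝕜) / (k.factorial : 𝕜)) • (DivLin ^ m) P := by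
  have hf : ∀ a : ℕ, (a.factorial : 𝕜) ≠ 0 := fun a => by exact_mod_cast a.factorial_ne_zero
  induction m with
  | zero => simp [hf]
  | succ m ih =>
    rw [Function.iterate_succ_apply', ih (by omega),
      div_of_isHomogeneous (isHomogeneous_smul _ (isHomogeneous_DivLin_pow hP m)), ← DivLin_apply,
      map_smul, smul_smul, pow_succ', Module.End.mul_apply]
    congr 1
    obtain ⟨r, rfl⟩ := Nat.exists_eq_add_of_le hm
    rw [show m + 1 + r - m = r + 1 by omega, show m + 1 + r - (m + 1) = r by omega,
      Nat.factorial_succ]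
    have h1 : ((r + 1 : ℕ) : 𝕜) ≠ 0 := by exact_mod_cast r.succ_ne_zero
    have := hf (m + 1 + r)
    rw [Nat.cast_mul]
    field_simp

theorem symbolPol_eq_sum_div (lam : 𝕜) {k : ℕ} {P : Pol n 𝕜} (hP : P.IsHomogeneous k) :
    symbolPol lam P = ∑ l ∈ range (k + 1), symbolCoeff n lam k l • div^[k - l] P := by
  rw [symbolPol_of_isHomogeneous lam hP, ← sum_range_reflect]
  refine sum_congr rfl fun l hl => ?_
  have hl' : l ≤ k := Nat.lt_succ_iff.mp (mem_range.mp hl)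
  rw [show k + 1 - 1 - l = k - l by omega, div_iterate (Nat.sub_le _ _) hP, smul_smul, divCoeff,
    Nat.sub_sub_self hl']

/-! ### The Casimir operator -/

/-- The Euler operator `x^j ∂_j` acting on coefficients. -/
def baseEuler : Pol n 𝕜 →ₗ[𝕜] Pol n 𝕜 :=
  ∑ j, LinearMap.mulLeft 𝕜 (C (coord j)) ∘ₗ pdPol j

theorem baseEuler_apply (P : Pol n 𝕜) : baseEuler P = ∑ j, C (coord j) * pdPol j P := by
  simp [baseEuler]

theorem C_pd_coord_mul (i j : Fin n) (P : Pol n 𝕜) :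
    C (pd i (coord j)) * P = if i = j then P else 0 := by
  rw [pd_coord, algebraMap_C_mul, ite_smul, one_smul, zero_smul]

theorem baseEuler_C_coord_mul (i : Fin n) (P : Pol n 𝕜) :
    baseEuler (C (coord i) * P) = C (coord i) * baseEuler P + C (coord i) * P := by
  simp [baseEuler_apply, pdPol_C_mul, C_pd_coord_mul, mul_add, sum_add_distrib, mul_sum,
    mul_left_comm]

/-- The vector field `∂_i`. -/
def translationField (i : Fin n) : VField n 𝕜 := fun j =>
  algebraMap 𝕜 (Smooth n 𝕜) (if i = j then 1 else 0)

/-- The vector field `x^i ∂_m`. -/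
def linearField (i m : Fin n) : VField n 𝕜 := fun j => if m = j then coord i else 0

/-- The vector field `x^j ∂_j`. -/
def eulerField : VField n 𝕜 := fun j => coord j

/-- The vector field `x^i x^j ∂_j`. -/
def quadraticField (i : Fin n) : VField n 𝕜 := fun j => coord i * coord j

theorem translationField_mem (i : Fin n) : translationField i ∈ projectiveAlgebra n 𝕜 :=
  ⟨fun j => if i = j then 1 else 0, 0, 0, fun j => by
    by_cases h : i = j <;> simp [translationField, h]⟩

theorem linearField_mem (i m : Fin n) : linearField i m ∈ projectiveAlgebra n 𝕜 :=
  ⟨0, fun s j => if i = s then if m = j then 1 else 0 else 0, 0, fun j => by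
    by_cases h : m = j <;> simp [linearField, h, apply_ite, ite_smul]⟩

theorem eulerField_mem : eulerField ∈ projectiveAlgebra n 𝕜 :=
  ⟨0, fun s j => if s = j then 1 else 0, 0, fun j => by
    simp [eulerField, apply_ite, ite_smul]⟩

theorem quadraticField_mem (i : Fin n) : quadraticField i ∈ projectiveAlgebra n 𝕜 :=
  ⟨0, 0, fun s => if i = s then 1 else 0, fun j => by
    simp [quadraticField, apply_ite, ite_smul]⟩

theorem liePol_translationField (i : Fin n) (P : Pol n 𝕜) :
    liePol (translationField i) P = pdPol i P := by
  simp only [liePol, translationField, pd_algebraMap, algebraMap_C_mul, ite_smul, one_smul,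
    zero_smul, map_zero, mul_zero, zero_mul, sum_const_zero, sub_zero, sum_ite_eq, mem_univ,
    if_true]

theorem liePol_linearField (i m : Fin n) (P : Pol n 𝕜) :
    liePol (linearField i m) P = C (coord i) * pdPol m P - X m * pderiv i P := by
  simp only [liePol, linearField, apply_ite C, apply_ite (pd _), mul_assoc, map_zero, ite_mul,
    zero_mul, C_pd_coord_mul, mul_ite, mul_zero, sum_ite_eq, sum_ite_eq', mem_univ, if_true]

theorem liePol_eulerField (P : Pol n 𝕜) :
    liePol eulerField P = baseEuler P - euler P := by
  simp only [liePol, eulerField, mul_assoc, C_pd_coord_mul, mul_ite, mul_zero, sum_ite_eq,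
    mem_univ, if_true, baseEuler_apply, euler_apply]

/-- The function `x^j ξ_j`. -/
def pairing : Pol n 𝕜 := ∑ j, X j * C (coord j)

/-- In `∂_m (x^i x^j)`, the term `δ_mj x^i` yields the Euler operator and `δ_mi x^j` yields the
pairing. -/
theorem liePol_quadraticField (i : Fin n) (P : Pol n 𝕜) :
    liePol (quadraticField i) P =
      C (coord i) * (baseEuler P - euler P) - pairing * pderiv i P := by
  have h : ∀ m, ∑ j, X j * C (pd m (coord i * coord j)) =
      C (coord i) * X m + if m = i then pairing (n := n) (𝕜 := 𝕜) else 0 := by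
    intro m
    have h1 : ∀ j, X j * C (pd m (coord i * coord j)) =
        C (pd m (coord j)) * (C (coord i) * X j) +
          C (pd m (coord i)) * (X j * C (coord j) : Pol n 𝕜) := by
      intro j
      rw [pd_mul, map_add, map_mul, map_mul]
      ring
    simp only [h1, C_pd_coord_mul, sum_add_distrib, sum_ite_eq, mem_univ, if_true,
      sum_ite_irrel, sum_const_zero, pairing]
  simp only [liePol, quadraticField, ← sum_mul, h]
  simp only [add_mul, ite_mul, zero_mul, sum_add_distrib, sum_ite_eq', mem_univ, if_true,
    map_mul, mul_assoc, ← mul_sum, ← baseEuler_apply, ← euler_apply]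
  ring

/-- The Casimir operator of `sl(n+1, ℝ)` acting on `Pol(T*ℝⁿ)`. -/
def casimir : Pol n 𝕜 →ₗ[𝕜] Pol n 𝕜 :=
  (∑ i, ∑ j, liePolLin (linearField i j) ∘ₗ liePolLin (linearField j i)) -
    (2 : 𝕜) • (∑ i, liePolLin (quadraticField i) ∘ₗ liePolLin (translationField i)) +
    liePolLin eulerField ∘ₗ liePolLin eulerField - ((n : 𝕜) + 1) • liePolLin eulerField

theorem euler_pdPol {k : ℕ} (i : Fin n) {P : Pol n 𝕜} (hP : P.IsHomogeneous k) :
    euler (pdPol i P) = (k : 𝕜) • pdPol i P :=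
  euler_eq_smul (isHomogeneous_pdPol i hP)

theorem sum_coord_mul_baseEuler (P : Pol n 𝕜) :
    ∑ i, C (coord i) * baseEuler (pdPol i P) = baseEuler (baseEuler P) - baseEuler P := by
  rw [baseEuler_apply P, map_sum, ← sum_sub_distrib]
  simp only [baseEuler_C_coord_mul, add_sub_cancel_right]

theorem sum_quadratic_translation {k : ℕ} {P : Pol n 𝕜} (hP : P.IsHomogeneous k) :
    ∑ i, liePol (quadraticField i) (liePol (translationField i) P) =
      baseEuler (baseEuler P) - baseEuler P - (k : 𝕜) • baseEuler P - pairing * DivLin P := by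
  simp only [liePol_translationField, liePol_quadraticField, euler_pdPol _ hP, mul_sub,
    sum_sub_distrib, sum_coord_mul_baseEuler, mul_smul_comm, pderiv_pdPol, DivLin_def,
    ← smul_sum, ← mul_sum, ← baseEuler_apply]

/-- Each `L_Y` here is `x^i ∂_m - ξ_m ∂_ξi`. The two mixed products both contract to the pairing
times `Div`; the pure ones reduce to Euler operators. -/
theorem sum_linear_linear {k : ℕ} {P : Pol n 𝕜} (hP : P.IsHomogeneous k) :
    ∑ i, ∑ j, liePol (linearField i j) (liePol (linearField j i) P) =
      baseEuler (baseEuler P) + ((n : 𝕜) - 1) • baseEuler P - (2 : 𝕜) • (pairing * DivLin P) +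
        ((k : 𝕜) * (k - 1 + n)) • P := by
  have h1 : ∀ Q : Pol n 𝕜, ∑ j, pdPol j (C (coord j) * Q) = baseEuler Q + (n : 𝕜) • Q := by
    intro Q
    simp [pdPol_C_mul, C_pd_coord_mul, sum_add_distrib, baseEuler_apply, Nat.cast_smul_eq_nsmul]
  have h2 : ∀ Q : Pol n 𝕜, ∑ j, pderiv j (X j * Q) = euler Q + (n : 𝕜) • Q := by
    intro Q
    simp only [pderiv_X_mul, if_true, sum_add_distrib, euler_apply]
    simp [Nat.cast_smul_eq_nsmul]
  have t1 : ∑ i, ∑ j, C (coord i) * pdPol j (C (coord j) * pdPol i P) =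
      baseEuler (baseEuler P) - baseEuler P + (n : 𝕜) • baseEuler P := by
    simp only [← mul_sum, h1, mul_add, sum_add_distrib, sum_coord_mul_baseEuler, mul_smul_comm,
      ← smul_sum, ← baseEuler_apply]
  have t2 : ∑ i, ∑ j, C (coord i) * pdPol j (X i * pderiv j P) = pairing * DivLin P := by
    simp only [pdPol_X_mul, ← mul_sum, ← DivLin_def]
    rw [pairing, sum_mul]
    exact sum_congr rfl fun i _ => by ring
  have t3 : ∑ i, ∑ j, X j * pderiv i (C (coord j) * pdPol i P) = pairing * DivLin P := by
    simp only [pderiv_C_mul, pderiv_pdPol]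
    rw [sum_comm]
    simp only [← mul_sum, ← DivLin_def, ← mul_assoc, ← sum_mul, pairing]
  have t4 : ∑ i, ∑ j, X j * pderiv i (X i * pderiv j P) = ((k : 𝕜) * (k - 1 + n)) • P := by
    rw [sum_comm]
    have e : ∀ j, euler (pderiv j P) = ((k : 𝕜) - 1) • pderiv j P := by
      intro j
      rcases k with _ | k
      · rw [pderiv_of_isHomogeneous_zero j hP, map_zero, smul_zero]
      · rw [euler_eq_smul (isHomogeneous_pderiv j hP)]
        simp
    simp only [← mul_sum, h2, e, ← add_smul, mul_smul_comm, ← smul_sum]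
    rw [euler_of_isHomogeneous hP, smul_smul, mul_comm]
  simp only [liePol_linearField, map_sub, mul_sub, sum_sub_distrib, t1, t2, t3, t4]
  module

/-- All terms in the base Euler operator and in the pairing cancel. The linear term `-(n+1)𝓔` of
`casimir` comes from reordering the symmetric sum over translations and quadratic fields so that
translations act first. -/
theorem casimir_of_isHomogeneous {k : ℕ} {P : Pol n 𝕜} (hP : P.IsHomogeneous k) :
    casimir P = (2 * (k : 𝕜) * (k + n)) • P := by
  have h1 : euler (baseEuler P) = (k : 𝕜) • baseEuler P := by
    refine euler_eq_smul ?_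
    rw [baseEuler_apply]
    exact IsHomogeneous.sum _ _ _ fun i _ => isHomogeneous_C_mul _ (isHomogeneous_pdPol i hP)
  simp only [casimir, LinearMap.sub_apply, LinearMap.add_apply, LinearMap.smul_apply,
    LinearMap.sum_apply, LinearMap.comp_apply, liePolLin_apply, sum_linear_linear hP,
    sum_quadratic_translation hP, liePol_eulerField, map_sub, euler_eq_smul hP, map_smul, h1]
  module

theorem casimir_eq_sum (P : Pol n 𝕜) : casimir P = ∑ j ∈ range (P.totalDegree + 1),
    (2 * (j : 𝕜) * (j + n)) • homogeneousComponent j P := by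
  conv_lhs => rw [← sum_homogeneousComponent P]
  rw [map_sum]
  exact sum_congr rfl fun j _ => casimir_of_isHomogeneous (homogeneousComponent_isHomogeneous j P)

theorem homogeneousComponent_smul (c : 𝕜) (j : ℕ) (P : Pol n 𝕜) :
    homogeneousComponent j (c • P) = c • homogeneousComponent j P := by
  rw [← algebraMap_smul (Smooth n 𝕜) c P, map_smul, algebraMap_smul]

theorem isHomogeneous_of_casimir_eq {k : ℕ} {P : Pol n 𝕜}
    (h : casimir P = (2 * (k : 𝕜) * (k + n)) • P) : P.IsHomogeneous k := by
  classical
  have hz : ∀ j, j ≠ k → homogeneousComponent j P = 0 := by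
    intro j hj
    by_cases hd : P.totalDegree < j
    · exact homogeneousComponent_eq_zero _ _ hd
    have h1 := congrArg (homogeneousComponent j) h
    rw [homogeneousComponent_smul, casimir_eq_sum, map_sum,
      sum_eq_single_of_mem j (mem_range.mpr (by omega)), homogeneousComponent_smul,
      homogeneousComponent_of_mem (homogeneousComponent_isHomogeneous j P), if_pos rfl] at h1
    · rw [← sub_eq_zero, ← sub_smul, smul_eq_zero] at h1
      refine h1.resolve_left fun h2 => ?_
      -- The eigenvalues differ by `2(j - k)(j + k + n)`; the last factor is a natural number that
      -- vanishes only if `j = k = 0`.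
      have h3 : ((j : 𝕜) - k) * ((j + k + n : ℕ) : 𝕜) = 0 := by
        push_cast
        linear_combination h2 / 2
      rcases mul_eq_zero.mp h3 with h4 | h4
      · exact hj (by exact_mod_cast sub_eq_zero.mp h4)
      · have : j + k + n = 0 := by exact_mod_cast h4
        omega
    · intro i _ hi
      rw [homogeneousComponent_smul,
        homogeneousComponent_of_mem (homogeneousComponent_isHomogeneous i P), if_neg hi.symm,
        smul_zero]
  rw [← sum_homogeneousComponent P]
  refine IsHomogeneous.sum _ _ _ fun j _ => ?_
  by_cases hj : j = k
  · exact hj ▸ homogeneousComponent_isHomogeneous j P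
  · rw [hz j hj]
    exact isHomogeneous_zero _ _ _

theorem leadingTerm_of_isHomogeneous {k : ℕ} {P : Pol n 𝕜} (hP : P.IsHomogeneous k) :
    leadingTerm P = P := by
  by_cases h : P = 0
  · simp [h, leadingTerm]
  · rw [leadingTerm, hP.totalDegree h, homogeneousComponent_of_mem hP, if_pos rfl]

/-! ### Rigidity, and the assembly of the theorem. -/

/-- `casimir` is a constant-coefficient polynomial in projective `L_Y`, so `T` commutes with it and
preserves its eigenspaces, the homogeneous components. A homogeneous polynomial is its own leading
term. -/
theorem eq_self_of_commute_liePol (T : Pol n 𝕜 →ₗ[𝕜] Pol n 𝕜)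
    (hT : ∀ Y ∈ projectiveAlgebra n 𝕜, ∀ P, T (liePol Y P) = liePol Y (T P))
    (hlead : ∀ P, leadingTerm (T P) = leadingTerm P) (P : Pol n 𝕜) : T P = P := by
  have hc : ∀ P, T (casimir P) = casimir (T P) := by
    intro P
    simp only [casimir, LinearMap.sub_apply, LinearMap.add_apply, LinearMap.smul_apply,
      LinearMap.sum_apply, LinearMap.comp_apply, liePolLin_apply, map_sub, map_add, map_smul,
      map_sum, hT _ (linearField_mem _ _), hT _ (translationField_mem _),
      hT _ (quadraticField_mem _), hT _ eulerField_mem]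
  induction P using MvPolynomial.induction_on' with
  | monomial α a =>
    have hh := isHomogeneous_monomial (n := α.degree) a rfl
    have h1 : (T (monomial α a)).IsHomogeneous α.degree := by
      refine isHomogeneous_of_casimir_eq ?_
      rw [← hc, casimir_of_isHomogeneous hh, map_smul]
    rw [← leadingTerm_of_isHomogeneous h1, hlead, leadingTerm_of_isHomogeneous hh]
  | add P Q hP hQ => rw [map_add, hP, hQ]

theorem lieDiffOp_normalOrdering (lam : 𝕜) {Y : VField n 𝕜} {c : Fin n → 𝕜}
    (h : HasProjectiveHessian Y c) (P : Pol n 𝕜) :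
    lieDiffOp lam Y (normalOrdering P) = normalOrdering (lieNormal lam Y c P) :=
  Subtype.ext (op_lieNormal lam h P)

/-- The projectively equivariant symbol map. -/
def projSymbol (lam : 𝕜) : DiffOp n 𝕜 ≃ₗ[𝕜] Pol n 𝕜 :=
  normalOrdering.symm.trans (LinearEquiv.ofBijective (symbolPol lam) (symbolPol_bijective lam))

theorem projSymbol_normalOrdering (lam : 𝕜) (P : Pol n 𝕜) :
    projSymbol lam (normalOrdering P) = symbolPol lam P := by
  simp [projSymbol]

theorem isSymbolMap_projSymbol (lam : 𝕜) : IsSymbolMap (projSymbol (n := n) lam) := by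
  intro A
  obtain ⟨P, rfl⟩ := normalOrdering.surjective A
  rw [projSymbol_normalOrdering, leadingTerm_symbolPol, principalSymbol,
    LinearEquiv.symm_apply_apply]

theorem isProjEquivariant_projSymbol (lam : 𝕜) :
    IsProjEquivariant lam (projSymbol (n := n) lam) := by
  intro Y hY A
  obtain ⟨P, rfl⟩ := normalOrdering.surjective A
  obtain ⟨c, hc⟩ := hasProjectiveHessian_of_mem hY
  rw [lieDiffOp_normalOrdering lam hc, projSymbol_normalOrdering, projSymbol_normalOrdering,
    symbolPol_lieNormal lam hc]

/-- Rigidity is applied to `τ ∘ σ⁻¹`. -/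
theorem IsProjEquivariant.eq {lam : 𝕜} {τ σ : DiffOp n 𝕜 ≃ₗ[𝕜] Pol n 𝕜}
    (hτ : IsProjEquivariant lam τ) (hσ : IsProjEquivariant lam σ)
    (hτ' : IsSymbolMap τ) (hσ' : IsSymbolMap σ) : τ = σ := by
  refine LinearEquiv.ext fun A => ?_
  have h := eq_self_of_commute_liePol (σ.symm.trans τ).toLinearMap (fun Y hY P => ?_)
    (fun P => ?_) (σ A)
  · simpa using h
  · obtain ⟨B, rfl⟩ := σ.surjective P
    simp [← hσ Y hY, hτ Y hY]
  · obtain ⟨B, rfl⟩ := σ.surjective P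
    simp [hτ' B, hσ' B]

end ProjectiveSymbol

end

theorem theorem4p1 {𝕜 : Type*} [RCLike 𝕜] (n : ℕ) (lam : 𝕜) :
    ∃ σ : ProjectiveSymbol.DiffOp n 𝕜 ≃ₗ[𝕜] ProjectiveSymbol.Pol n 𝕜,
      (ProjectiveSymbol.IsSymbolMap σ ∧ ProjectiveSymbol.IsProjEquivariant lam σ) ∧
      (∀ τ : ProjectiveSymbol.DiffOp n 𝕜 ≃ₗ[𝕜] ProjectiveSymbol.Pol n 𝕜,
        ProjectiveSymbol.IsSymbolMap τ → ProjectiveSymbol.IsProjEquivariant lam τ → τ = σ) ∧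
      ProjectiveSymbol.IsDifferential σ ∧
      ∀ (k : ℕ) (P : ProjectiveSymbol.Pol n 𝕜), P.IsHomogeneous k →
        σ (ProjectiveSymbol.normalOrdering P) =
          ∑ l ∈ Finset.range (k + 1),
            ProjectiveSymbol.symbolCoeff n lam k l • ProjectiveSymbol.div^[k - l] P := by
  open ProjectiveSymbol in
  refine ⟨projSymbol lam, ⟨isSymbolMap_projSymbol lam, isProjEquivariant_projSymbol lam⟩,
    fun τ hτ hτ' => hτ'.eq (isProjEquivariant_projSymbol lam) hτ (isSymbolMap_projSymbol lam),
    fun k => ⟨⟨k, fun P hP => ?_⟩, fun α β _ => ?_⟩, fun k P hP => ?_⟩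
  · rw [projSymbol_normalOrdering]
    exact totalDegree_symbolPol_le lam hP
  · obtain ⟨D, hD, hDa⟩ := isDiffFamily_symbolPol lam α β
    exact ⟨D, hD, fun a => by rw [projSymbol_normalOrdering, hDa]⟩
  · rw [projSymbol_normalOrdering, symbolPol_eq_sum_div lam hP]
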